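/- All $C^*$-algebras are unital. For a $C^*$-algebra $A$ let $P_A$ be the set of continuous functions $f\colon[0,\infty)\to\mathbb R$ that are $A$-monotone: for all self-adjoint $x,y\in A$ with spectrum in $[0,\infty)$, $x\le y$ implies $f(x)\le f(y)$, where $f(x)$ is defined by the continuous functional calculus. For $n\in\mathbb N$ write $P_n=P_{M_n}$, where $M_n$ is the $C^*$-algebra of complex $n\times n$ matrices. A representation of $A$ is a unital $*$-homomorphism $\pi\colon A\to B(H)$ into the bounded operators on a complex Hilbert space $H$; it is irreducible if $H\neq 0$ and $0$ and $H$ are the only closed $\pi(A)$-invariant subspaces of $H$, and $\dim\pi=\dim H\in\mathbb N\cup\{\infty\}$. Let $A$ be a $C^*$-algebra and, with suprema taken in $\mathbb N\cup\{\infty\}$ (so $\sup\emptyset=0$), let $$n_0=\sup\{k\in\mathbb N : k\ge 1,\ P_A\subseteq P_k\},\qquad n_1=\sup\{\dim\pi : \pi \text{ is an irreducible representation of } A\}.$$ Then $n_0=n_1$. Moreover, if $n_1<\infty$, then $P_A=P_{n_1}$. (If $A\ne0$ then $n_1\ge1$; in the degenerate case $A=0$ one has $n_1=0$, and $P_0$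 is the set of all continuous functions on $[0,\infty)$.) -/

import Mathlib

/-- The class `P_A(I)` of `A`-monotone functions on `I` for a unital C⋆-algebra `A`: the functions
that are continuous on `I` and satisfy `f(x) ≤ f(y)` for all self-adjoint `x ≤ y` in `A` with
spectrum in `I`, where `f(x)` is given by the continuous functional calculus. Real functions on `I`
are represented by functions on `ℝ`, whose values outside `I` play no role. -/
def monotoneClass (A : Type*) [CStarAlgebra A] [PartialOrder A] [StarOrderedRing A]
    (I : Set ℝ) : Set (ℝ → ℝ) :=
  {f | ContinuousOn f I ∧ ∀ x y : A, IsSelfAdjoint x → IsSelfAdjoint y →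
    spectrum ℝ x ⊆ I → spectrum ℝ y ⊆ I → x ≤ y → cfc f x ≤ cfc f y}

open scoped ComplexOrder in
/-- The class `P_n(I)` of matrix monotone functions of order `n` on `I`: the class `P_A(I)` for the
C⋆-algebra `A = M_n` of complex `n × n` matrices. -/
def matrixMonotoneClass (n : ℕ) (I : Set ℝ) : Set (ℝ → ℝ) :=
  monotoneClass (CStarMatrix (Fin n) (Fin n) ℂ) I

/-- A representation `π` of a unital C⋆-algebra on a Hilbert space `H` is (topologically)
irreducible if `H ≠ 0` and the only closed `π`-invariant subspaces of `H` are `0` and `H`. -/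
def IsIrreducibleRep {A H : Type*} [CStarAlgebra A] [NormedAddCommGroup H]
    [InnerProductSpace ℂ H] [CompleteSpace H] (π : A →⋆ₐ[ℂ] (H →L[ℂ] H)) : Prop :=
  Nontrivial H ∧ ∀ K : Submodule ℂ H, IsClosed (K : Set H) →
    (∀ a : A, ∀ x ∈ K, π a x ∈ K) → K = ⊥ ∨ K = ⊤

/-- The set of dimensions (in `ℕ ∪ {∞}`) of the irreducible representations of `A`. Every
irreducible representation of `A` has a cyclic vector, so its space is, up to a unitary, a
completion of a quotient of `A`; hence Hilbert spaces in the universe of `A` give all of them. -/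
def irrepDims.{u} (A : Type u) [CStarAlgebra A] : Set ℕ∞ :=
  {d | ∃ (H : Type u) (_ : NormedAddCommGroup H) (_ : InnerProductSpace ℂ H)
    (_ : CompleteSpace H) (π : A →⋆ₐ[ℂ] (H →L[ℂ] H)),
    IsIrreducibleRep π ∧ d = Cardinal.toENat (Module.rank ℂ H)}

open Filter Topology ContinuousLinearMap

/-! Three facts combine.

(1) An irreducible representation `π` on `H` with `n ≤ dim H` gives `P_A ⊆ P_n`. Fix an isometry `V`
from `ℂⁿ` into `H`. Schur's lemma yields the density theorem, in a self-adjoint form: each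
self-adjoint `u` on `ℂⁿ` admits self-adjoint `h_m` in `A` with `π(h_m) V → V u`. Kaplansky's
function `2t/(1+t²)` makes the `h_m` bounded, and then the convergence passes through products and
continuous functions. For `0 ≤ x ≤ y`, write `x = w²` and `y - x = v²`, and approximate `w`, `v` by
`h_m`, `k_m`. Since `h_m² ≤ h_m² + k_m²` holds in `A`, monotonicity of `f` applies there; applying
`π`, compressing by `V` and taking limits gives `f(x) ≤ f(y)`
(`ApproximatesSelfAdjoint.monotoneClass_subset`).

(2) If every irreducible representation has dimension at most `n`, then `P_n ⊆ P_A`. Irreducible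
representations detect positivity: a non-positive self-adjoint element is negative at some pure
state, and the GNS representation of that state is irreducible
(`exists_isIrreducibleRep_not_nonneg`). The inequality `f(x) ≤ f(y)` may therefore be checked in
each representation, where it follows from matrix monotonicity.

(3) The classes differ: `P_m ⊄ P_n` for `m < n` (`exists_monotoneClass_gap`). The witness is a
polynomial whose coefficients form a Hankel matrix with positive definite leading `N × N` block,
followed by a top coefficient `-1` that only dimension `N + 1` can see. It is monotone only near
`0`, and a Möbius map carries a bounded interval to `[0, ∞)`.

By (1), every `n ≤ n₁` satisfies `P_A ⊆ P_n`. If this held for some `n > n₁ = m`, then (2) would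
give `P_m ⊆ P_A ⊆ P_n`, against (3). For finite `n₁`, (1) and (2) together give equality. -/

theorem norm_cfc_sub_aeval_le {A : Type*} [CStarAlgebra A] {f : ℝ → ℝ} {s : Set ℝ} {a : A}
    (ha : IsSelfAdjoint a) (hs : spectrum ℝ a ⊆ s) (hf : ContinuousOn f s) {δ : ℝ} (hδ : 0 < δ)
    {q : Polynomial ℝ} (hq : ∀ x ∈ s, |q.eval x - f x| < δ) :
    ‖cfc f a - Polynomial.aeval a q‖ ≤ δ := by
  rw [← cfc_polynomial q a, ← cfc_sub f q.eval a (hf.mono hs) (by fun_prop)]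
  refine norm_cfc_le hδ.le fun x hx => ?_
  rw [Real.norm_eq_abs, abs_sub_comm]
  exact (hq x (hs hx)).le

theorem abs_le_norm_of_mem_spectrum {A : Type*} [CStarAlgebra A] {a : A} {t : ℝ}
    (ht : t ∈ spectrum ℝ a) : |t| ≤ ‖a‖ := by
  cases subsingleton_or_nontrivial A
  · simp at ht
  · exact spectrum.norm_le_norm_of_mem ht

theorem StarAlgHom.map_cfc_real {A B : Type*} [CStarAlgebra A] [CStarAlgebra B] (π : A →⋆ₐ[ℂ] B)
    {f : ℝ → ℝ} {a : A} (ha : IsSelfAdjoint a) (hf : ContinuousOn f (spectrum ℝ a)) :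
    π (cfc f a) = cfc f (π a) :=
  StarAlgHomClass.map_cfc π f a
    (hφ := NonUnitalStarAlgHom.instContinuousLinearMapClassComplex.map_continuous π)
    (hφa := ha.map π)

theorem StarAlgHom.norm_apply_le' {A B : Type*} [CStarAlgebra A] [CStarAlgebra B] (π : A →⋆ₐ[ℂ] B)
    (a : A) : ‖π a‖ ≤ ‖a‖ := NonUnitalStarAlgHom.norm_apply_le π a

/-! ### Functional calculus under limits of the form `T_m V → V u`. -/

section Intertwining

variable {E H : Type*} [NormedAddCommGroup E] [InnerProductSpace ℂ E] [CompleteSpace E]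
  [NormedAddCommGroup H] [InnerProductSpace ℂ H] {V : E →L[ℂ] H}

/-- The uniform bound on `T` is what controls the term `T_m (S_m V - V w)`; this is why approximants
have to be truncated before they are multiplied. -/
theorem tendsto_comp_mul {T S : ℕ → H →L[ℂ] H} {u w : E →L[ℂ] E} {C : ℝ} (hb : ∀ m, ‖T m‖ ≤ C)
    (hT : Tendsto (fun m => T m ∘L V) atTop (𝓝 (V ∘L u)))
    (hS : Tendsto (fun m => S m ∘L V) atTop (𝓝 (V ∘L w))) :
    Tendsto (fun m => (T m * S m) ∘L V) atTop (𝓝 (V ∘L (u * w))) := by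
  have h1 : ∀ m, (T m * S m) ∘L V = T m ∘L (S m ∘L V - V ∘L w) + (T m ∘L V) ∘L w := by
    intro m; ext x; simp
  simp_rw [h1]
  have h2 : Tendsto (fun m => T m ∘L (S m ∘L V - V ∘L w)) atTop (𝓝 0) := by
    have h3 : Tendsto (fun m => C * ‖S m ∘L V - V ∘L w‖) atTop (𝓝 (C * 0)) :=
      (tendsto_iff_norm_sub_tendsto_zero.1 hS).const_mul C
    rw [mul_zero] at h3
    refine squeeze_zero_norm (fun m => ?_) h3
    exact (opNorm_comp_le _ _).trans (mul_le_mul_of_nonneg_right (hb m) (norm_nonneg _))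
  have h4 : Tendsto (fun m => (T m ∘L V) ∘L w) atTop (𝓝 ((V ∘L u) ∘L w)) :=
    ((compL ℂ E E H).flip w).continuous.continuousAt.tendsto.comp hT
  simpa using! h2.add h4

theorem tendsto_comp_aeval {T : ℕ → H →L[ℂ] H} {u : E →L[ℂ] E} {C : ℝ} (hb : ∀ m, ‖T m‖ ≤ C)
    (hT : Tendsto (fun m => T m ∘L V) atTop (𝓝 (V ∘L u))) (q : Polynomial ℝ) :
    Tendsto (fun m => (Polynomial.aeval (T m) q) ∘L V) atTop (𝓝 (V ∘L (Polynomial.aeval u q))) := by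
  have hpow : ∀ n : ℕ, Tendsto (fun m => (T m ^ n) ∘L V) atTop (𝓝 (V ∘L (u ^ n))) := by
    intro n
    induction n with
    | zero =>
      have h : (1 : H →L[ℂ] H) ∘L V = V ∘L 1 := by ext; simp
      simp_rw [pow_zero, h]
      exact tendsto_const_nhds
    | succ n ih => simp_rw [pow_succ']; exact tendsto_comp_mul hb hT ih
  induction q using Polynomial.induction_on' with
  | add p q hp hq =>
    simp only [map_add]
    simpa [add_comp, comp_add] using hp.add hq
  | monomial n a =>
    simp only [Polynomial.aeval_monomial, Algebra.algebraMap_eq_smul_one, smul_mul_assoc, one_mul]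
    have := (hpow n).const_smul a
    convert! this using 2
    ext x
    simp only [comp_apply, smul_apply]
    rw [← Complex.coe_smul, ← Complex.coe_smul, map_smul]

variable [CompleteSpace H]

/-- One polynomial approximates `f` on an interval containing all the spectra, so the error is
uniform in `m` and the polynomial case suffices. -/
theorem tendsto_comp_cfc {T : ℕ → H →L[ℂ] H} {u : E →L[ℂ] E} {b C : ℝ} {f : ℝ → ℝ}
    (hb : ∀ m, ‖T m‖ ≤ C) (hTs : ∀ m, IsSelfAdjoint (T m)) (hus : IsSelfAdjoint u)
    (hTσ : ∀ m, spectrum ℝ (T m) ⊆ Set.Icc 0 b) (huσ : spectrum ℝ u ⊆ Set.Icc 0 b)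
    (hf : ContinuousOn f (Set.Icc 0 b))
    (hT : Tendsto (fun m => T m ∘L V) atTop (𝓝 (V ∘L u))) :
    Tendsto (fun m => cfc f (T m) ∘L V) atTop (𝓝 (V ∘L cfc f u)) := by
  rw [Metric.tendsto_atTop]
  intro ε hε
  set δ := ε / (3 * (‖V‖ + 1)) with hδ
  have hV : 0 ≤ ‖V‖ := norm_nonneg V
  have hδ0 : 0 < δ := by positivity
  have hδV : δ * ‖V‖ ≤ ε / 3 := by
    have : δ * (‖V‖ + 1) = ε / 3 := by rw [hδ]; field_simp
    nlinarith
  obtain ⟨q, hq⟩ := exists_polynomial_near_of_continuousOn 0 b f hf δ hδ0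
  obtain ⟨N, hN⟩ := Metric.tendsto_atTop.1 (tendsto_comp_aeval hb hT q) (ε / 3) (by positivity)
  refine ⟨N, fun m hm => ?_⟩
  have h1 : ‖(cfc f (T m) - Polynomial.aeval (T m) q) ∘L V‖ ≤ ε / 3 :=
    ((opNorm_comp_le _ _).trans (mul_le_mul_of_nonneg_right
      (norm_cfc_sub_aeval_le (hTs m) (hTσ m) hf hδ0 hq) hV)).trans hδV
  have h2 : ‖V ∘L (cfc f u - Polynomial.aeval u q)‖ ≤ ε / 3 := by
    refine ((opNorm_comp_le _ _).trans (mul_le_mul_of_nonneg_left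
      (norm_cfc_sub_aeval_le hus huσ hf hδ0 hq) hV)).trans ?_
    rwa [mul_comm]
  have h3 := hN m hm
  rw [dist_eq_norm] at h3 ⊢
  have h4 : cfc f (T m) ∘L V - V ∘L cfc f u =
      (cfc f (T m) - Polynomial.aeval (T m) q) ∘L V +
      ((Polynomial.aeval (T m) q) ∘L V - V ∘L (Polynomial.aeval u q)) -
      V ∘L (cfc f u - Polynomial.aeval u q) := by
    simp only [sub_comp, comp_sub]; abel
  rw [h4]
  calc _ ≤ _ := norm_sub_le _ _
    _ ≤ _ := add_le_add_left (norm_add_le _ _) _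
    _ < ε := by linarith

/-- The properties of the resolvent-type function `1 / (1 + t ^ 2)` used to truncate unbounded
approximations. -/
theorem cfc_truncation {A : Type*} [CStarAlgebra A] {a : A} (ha : IsSelfAdjoint a) :
    ∃ r : A, ‖r‖ ≤ 1 ∧ ‖r * a‖ ≤ 1 ∧ r * (1 + a * a) = 1 ∧ (1 + a * a) * r = 1 ∧
      cfc (fun t : ℝ => 2 * t / (1 + t ^ 2)) a = (2 : ℂ) • (r * a) ∧
      cfc (fun t : ℝ => 2 * t / (1 + t ^ 2)) a = (2 : ℂ) • (a * r) := by
  have hne : ∀ t : ℝ, 1 + t ^ 2 ≠ 0 := fun t => by positivity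
  have hc : Continuous (fun t : ℝ => 1 / (1 + t ^ 2)) := by
    exact continuous_const.div (by fun_prop) hne
  have hid : cfc (fun t : ℝ => t) a = a := cfc_id' ℝ a
  have hpol : cfc (fun t : ℝ => 1 + t * t) a = 1 + a * a := by
    rw [cfc_add (hf := by fun_prop) (hg := by fun_prop), cfc_mul (hf := by fun_prop)
      (hg := by fun_prop), hid, cfc_const_one ℝ a]
  have hra : cfc (fun t : ℝ => 1 / (1 + t ^ 2) * t) a =
      cfc (fun t : ℝ => 1 / (1 + t ^ 2)) a * a := by
    rw [cfc_mul _ _ a hc.continuousOn (by fun_prop), hid]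
  have har : cfc (fun t : ℝ => t * (1 / (1 + t ^ 2))) a =
      a * cfc (fun t : ℝ => 1 / (1 + t ^ 2)) a := by
    rw [cfc_mul _ _ a (by fun_prop) hc.continuousOn, hid]
  have htwo : ∀ (g : ℝ → ℝ), Continuous g → (2 : ℂ) • cfc g a = cfc (fun t => 2 * g t) a := by
    intro g hg
    rw [cfc_const_mul 2 g a hg.continuousOn, ← Complex.coe_smul]; norm_num
  refine ⟨cfc (fun t : ℝ => 1 / (1 + t ^ 2)) a, ?_, ?_, ?_, ?_, ?_, ?_⟩
  · refine norm_cfc_le zero_le_one fun t _ => ?_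
    rw [Real.norm_eq_abs, abs_of_nonneg (by positivity), div_le_one (by positivity)]
    nlinarith [sq_nonneg t]
  · rw [← hra]
    refine norm_cfc_le zero_le_one fun t _ => ?_
    rw [Real.norm_eq_abs, one_div_mul_eq_div, abs_div,
      abs_of_nonneg (by positivity : 0 ≤ 1 + t ^ 2),
      div_le_one (by positivity)]
    nlinarith [sq_nonneg (|t| - 1), sq_abs t]
  · rw [← hpol, ← cfc_mul _ _ a hc.continuousOn (by fun_prop), ← cfc_const_one ℝ a]
    refine cfc_congr fun t _ => ?_
    have := hne t
    field_simp
  · rw [← hpol, ← cfc_mul _ _ a (by fun_prop) hc.continuousOn, ← cfc_const_one ℝ a]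
    refine cfc_congr fun t _ => ?_
    have := hne t
    field_simp
  · rw [← hra, htwo (fun t => 1 / (1 + t ^ 2) * t) (hc.mul continuous_id)]
    refine cfc_congr fun t _ => ?_
    ring
  · rw [← har, htwo (fun t => t * (1 / (1 + t ^ 2))) (continuous_id.mul hc)]
    refine cfc_congr fun t _ => ?_
    ring

/-- No bound on `T_m` is needed. With `R = (1 + T²)⁻¹`, `r = (1 + u²)⁻¹` and `D = T V - V u`,
expanding `R T V (1 + u²) r - R (1 + T²) V u r` leaves `R D r - R T D u r`, and both `R` and `R T`
are contractions. -/
theorem tendsto_comp_truncation {T : ℕ → H →L[ℂ] H} {u : E →L[ℂ] E}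
    (hTs : ∀ m, IsSelfAdjoint (T m)) (hus : IsSelfAdjoint u)
    (hT : Tendsto (fun m => T m ∘L V) atTop (𝓝 (V ∘L u))) :
    Tendsto (fun m => cfc (fun t : ℝ => 2 * t / (1 + t ^ 2)) (T m) ∘L V) atTop
      (𝓝 (V ∘L cfc (fun t : ℝ => 2 * t / (1 + t ^ 2)) u)) := by
  obtain ⟨r, -, -, -, hr, -, hu⟩ := cfc_truncation hus
  choose R hR1 hR2 hR3 hR4 hR5 hR6 using fun m => cfc_truncation (hTs m)
  set D : ℕ → E →L[ℂ] H := fun m => T m ∘L V - V ∘L u with hD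
  have hD0 : Tendsto (fun m => ‖D m‖) atTop (𝓝 0) := tendsto_iff_norm_sub_tendsto_zero.1 hT
  have key : ∀ m, cfc (fun t : ℝ => 2 * t / (1 + t ^ 2)) (T m) ∘L V -
      V ∘L cfc (fun t : ℝ => 2 * t / (1 + t ^ 2)) u =
      (2 : ℂ) • (R m ∘L (D m ∘L r) - (R m * T m) ∘L (D m ∘L (u * r))) := by
    intro m
    rw [hu, hR5]
    ext x
    have hx : x = r x + u (u (r x)) := by
      have := congrArg (fun S : E →L[ℂ] E => S x) hr
      simpa [add_mul] using! this.symm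
    have hR : ∀ z, z = R m z + R m (T m (T m z)) := fun z => by
      have := congrArg (fun S : H →L[ℂ] H => S z) (hR3 m)
      simpa [mul_add] using! this.symm
    have e1 : V x = V (r x) + V (u (u (r x))) := by rw [← map_add, ← hx]
    have e2 := hR (V (u (r x)))
    simp only [sub_apply, comp_apply, smul_apply, mul_apply_eq_comp, hD, e1, map_add, map_sub,
      map_smul]
    conv_lhs => rw [e2]
    module
  rw [tendsto_iff_norm_sub_tendsto_zero]
  have hlim : Tendsto (fun m => 2 * (‖D m‖ * ‖r‖ + ‖D m‖ * ‖u * r‖)) atTop (𝓝 0) := by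
    simpa using ((hD0.mul_const ‖r‖).add (hD0.mul_const ‖u * r‖)).const_mul 2
  refine squeeze_zero (fun _ => norm_nonneg _) (fun m => ?_) hlim
  rw [key, norm_smul, Complex.norm_ofNat]
  gcongr
  refine (norm_sub_le _ _).trans (add_le_add ?_ ?_)
  · calc _ ≤ ‖R m‖ * ‖D m ∘L r‖ := opNorm_comp_le _ _
      _ ≤ 1 * (‖D m‖ * ‖r‖) := mul_le_mul (hR1 m) (opNorm_comp_le _ _) (norm_nonneg _) zero_le_one
      _ = _ := one_mul _
  · calc _ ≤ ‖R m * T m‖ * ‖D m ∘L (u * r)‖ := opNorm_comp_le _ _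
      _ ≤ 1 * (‖D m‖ * ‖u * r‖) :=
        mul_le_mul (hR2 m) (opNorm_comp_le _ _) (norm_nonneg _) zero_le_one
      _ = _ := one_mul _

end Intertwining

/-- Every self-adjoint operator on `E` is the limit, along the embedding `V`, of the images of
self-adjoint elements of `A`. -/
def ApproximatesSelfAdjoint {A E H : Type*} [CStarAlgebra A] [NormedAddCommGroup E]
    [InnerProductSpace ℂ E] [CompleteSpace E] [NormedAddCommGroup H] [InnerProductSpace ℂ H]
    [CompleteSpace H] (π : A →⋆ₐ[ℂ] (H →L[ℂ] H)) (V : E →L[ℂ] H) : Prop :=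
  ∀ u : E →L[ℂ] E, IsSelfAdjoint u → ∃ h : ℕ → A, (∀ m, IsSelfAdjoint (h m)) ∧
    Tendsto (fun m => π (h m) ∘L V) atTop (𝓝 (V ∘L u))

/-! ### Kaplansky truncation and compression of monotonicity to a subspace. -/

section Compression

variable {A E H : Type*} [CStarAlgebra A] [NormedAddCommGroup E]
  [InnerProductSpace ℂ E] [CompleteSpace E] [NormedAddCommGroup H] [InnerProductSpace ℂ H]
  [CompleteSpace H] {π : A →⋆ₐ[ℂ] (H →L[ℂ] H)} {V : E →L[ℂ] H}

theorem continuous_truncation : Continuous fun t : ℝ => 2 * t / (1 + t ^ 2) :=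
  Continuous.div (by fun_prop) (by fun_prop) fun t => by positivity

/-- The truncation `2 t / (1 + t ^ 2)` maps `[-1, 1]` onto itself, so contractions are values
of it. -/
theorem exists_cfc_truncation_eq {B : Type*} [CStarAlgebra B] {w : B} (hw : IsSelfAdjoint w)
    (h1 : ‖w‖ ≤ 1) :
    ∃ u : B, IsSelfAdjoint u ∧ cfc (fun t : ℝ => 2 * t / (1 + t ^ 2)) u = w := by
  have hne : ∀ t : ℝ, 1 + √(1 - t ^ 2) ≠ 0 := fun t => by positivity
  have hc : Continuous fun t : ℝ => t / (1 + √(1 - t ^ 2)) :=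
    continuous_id.div (by fun_prop) hne
  -- The function `t / (1 + √(1 - t²))` is a right inverse of `2t/(1+t²)` on `[-1, 1]`.
  refine ⟨cfc (fun t : ℝ => t / (1 + √(1 - t ^ 2))) w, cfc_predicate _ _, ?_⟩
  rw [← cfc_comp' _ _ w continuous_truncation.continuousOn hc.continuousOn]
  conv_rhs => rw [← cfc_id' ℝ w]
  refine cfc_congr fun t ht => ?_
  have htn : |t| ≤ 1 := (abs_le_norm_of_mem_spectrum ht).trans h1
  have h0 : 0 ≤ 1 - t ^ 2 := by nlinarith [abs_nonneg t, sq_abs t]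
  have hs := Real.sq_sqrt h0
  have hp : 0 ≤ √(1 - t ^ 2) := Real.sqrt_nonneg _
  generalize √(1 - t ^ 2) = r at hs hp
  have h3 : (1 + r) ^ 2 + t ^ 2 = 2 * (1 + r) := by nlinarith
  rw [div_pow, one_add_div (by positivity), h3]
  field_simp

theorem exists_smul_cfc_truncation_eq {B : Type*} [CStarAlgebra B] {w : B}
    (hw : IsSelfAdjoint w) :
    ∃ (c : ℝ) (u : B), 0 ≤ c ∧ IsSelfAdjoint u ∧
      (c : ℂ) • cfc (fun t : ℝ => 2 * t / (1 + t ^ 2)) u = w := by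
  set c : ℝ := ‖w‖ + 1 with hcdef
  have hc : 0 < c := by positivity
  have hn : ‖c⁻¹ • w‖ ≤ 1 := by
    rw [norm_smul, norm_inv, Real.norm_of_nonneg hc.le, inv_mul_le_one₀ hc]
    simp [c]
  obtain ⟨u, hu, huw⟩ := exists_cfc_truncation_eq (IsSelfAdjoint.smul (IsSelfAdjoint.all c⁻¹) hw) hn
  refine ⟨c, u, hc.le, hu, ?_⟩
  rw [huw, Complex.coe_smul, smul_smul, mul_inv_cancel₀ hc.ne', one_smul]

theorem norm_cfc_truncation_le {B : Type*} [CStarAlgebra B] (a : B) :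
    ‖cfc (fun t : ℝ => 2 * t / (1 + t ^ 2)) a‖ ≤ 1 := by
  refine norm_cfc_le zero_le_one fun t _ => ?_
  rw [Real.norm_eq_abs, abs_div,
      abs_of_nonneg (by positivity : 0 ≤ 1 + t ^ 2),
    div_le_one (by positivity), abs_mul, abs_two]
  nlinarith [sq_nonneg (|t| - 1), sq_abs t]

theorem ApproximatesSelfAdjoint.exists_bounded (hV : ApproximatesSelfAdjoint π V)
    {w : E →L[ℂ] E} (hw : IsSelfAdjoint w) :
    ∃ (C : ℝ) (h : ℕ → A), (∀ m, IsSelfAdjoint (h m)) ∧ (∀ m, ‖h m‖ ≤ C) ∧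
      Tendsto (fun m => π (h m) ∘L V) atTop (𝓝 (V ∘L w)) := by
  obtain ⟨c, u, hc, hu, rfl⟩ := exists_smul_cfc_truncation_eq hw
  obtain ⟨h, hs, hlim⟩ := hV u hu
  refine ⟨c, fun m => (c : ℂ) • cfc (fun t : ℝ => 2 * t / (1 + t ^ 2)) (h m),
    fun m => IsSelfAdjoint.smul (Complex.conj_ofReal c) (cfc_predicate _ _), fun m => ?_, ?_⟩
  · rw [norm_smul, Complex.norm_of_nonneg hc]
    exact mul_le_of_le_one_right hc (norm_cfc_truncation_le _)
  · have h1 := (tendsto_comp_truncation (fun m => (hs m).map π) hu hlim).const_smul (c : ℂ)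
    have h2 : ∀ m, π ((c : ℂ) • cfc (fun t : ℝ => 2 * t / (1 + t ^ 2)) (h m)) ∘L V =
        (c : ℂ) • (cfc (fun t : ℝ => 2 * t / (1 + t ^ 2)) (π (h m)) ∘L V) := fun m => by
      rw [map_smul, StarAlgHom.map_cfc_real π (hs m) continuous_truncation.continuousOn, smul_comp]
    simp_rw [h2, comp_smul]
    exact h1

variable [PartialOrder A] [StarOrderedRing A]

theorem ApproximatesSelfAdjoint.monotoneClass_subset (hV : ApproximatesSelfAdjoint π V)
    (hiso : adjoint V ∘L V = 1) :
    monotoneClass A (Set.Ici 0) ⊆ monotoneClass (E →L[ℂ] E) (Set.Ici 0) := by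
  rintro f ⟨hfc, hf⟩
  refine ⟨hfc, fun x y hx hy hxσ hyσ hxy => ?_⟩
  have hx0 : 0 ≤ x := by
    exact (StarOrderedRing.nonneg_iff_spectrum_nonneg (R := ℝ) x hx).2 fun t ht => hxσ ht
  -- Approximating square roots and squaring afterwards makes the approximants of `x` and `y - x`
  -- positive, so the order relation holds exactly in `A` and not only in the limit.
  obtain ⟨w, hw, hwx⟩ : ∃ w : E →L[ℂ] E, IsSelfAdjoint w ∧ w * w = x :=
    ⟨CFC.sqrt x, (CFC.sqrt_nonneg x).isSelfAdjoint, CFC.sqrt_mul_sqrt_self x⟩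
  obtain ⟨v, hv, hvz⟩ : ∃ v : E →L[ℂ] E, IsSelfAdjoint v ∧ v * v = y - x :=
    ⟨CFC.sqrt (y - x), (CFC.sqrt_nonneg _).isSelfAdjoint,
      CFC.sqrt_mul_sqrt_self _ (sub_nonneg.2 hxy)⟩
  obtain ⟨C, h, hhs, hhb, hh⟩ := hV.exists_bounded hw
  obtain ⟨D, k, hks, hkb, hk⟩ := hV.exists_bounded hv
  have hπ : ∀ a : A, ‖π a‖ ≤ ‖a‖ := StarAlgHom.norm_apply_le' π
  have ha0 : ∀ m, 0 ≤ h m * h m := fun m => (hhs m).mul_self_nonneg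
  have hc0 : ∀ m, 0 ≤ k m * k m := fun m => (hks m).mul_self_nonneg
  have hC0 : 0 ≤ C := (norm_nonneg _).trans (hhb 0)
  have hD0 : 0 ≤ D := (norm_nonneg _).trans (hkb 0)
  have hab : ∀ m, ‖h m * h m‖ ≤ C * C := fun m =>
    (norm_mul_le _ _).trans (mul_le_mul (hhb m) (hhb m) (norm_nonneg _) hC0)
  have hcb : ∀ m, ‖k m * k m‖ ≤ D * D := fun m =>
    (norm_mul_le _ _).trans (mul_le_mul (hkb m) (hkb m) (norm_nonneg _) hD0)
  have hmain : ∀ m, cfc f (π (h m * h m)) ≤ cfc f (π (h m * h m + k m * k m)) := by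
    intro m
    have h1 : 0 ≤ h m * h m + k m * k m := add_nonneg (ha0 m) (hc0 m)
    have h2 := hf (h m * h m) (h m * h m + k m * k m) (ha0 m).isSelfAdjoint h1.isSelfAdjoint
      (fun t ht => spectrum_nonneg_of_nonneg (ha0 m) ht)
      (fun t ht => spectrum_nonneg_of_nonneg h1 ht) (le_add_of_nonneg_right (hc0 m))
    have h3 : π (cfc f (h m * h m)) ≤ π (cfc f (h m * h m + k m * k m)) := OrderHomClass.mono π h2
    rwa [StarAlgHom.map_cfc_real π (ha0 m).isSelfAdjoint
        (hfc.mono fun t ht => spectrum_nonneg_of_nonneg (ha0 m) ht),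
      StarAlgHom.map_cfc_real π h1.isSelfAdjoint
        (hfc.mono fun t ht => spectrum_nonneg_of_nonneg h1 ht)] at h3
  have hlimx : Tendsto (fun m => π (h m * h m) ∘L V) atTop (𝓝 (V ∘L x)) := by
    simp_rw [map_mul, ← hwx]
    exact tendsto_comp_mul (fun m => (hπ _).trans (hhb m)) hh hh
  have hlimy : Tendsto (fun m => π (h m * h m + k m * k m) ∘L V) atTop (𝓝 (V ∘L y)) := by
    have h1 : Tendsto (fun m => π (k m * k m) ∘L V) atTop (𝓝 (V ∘L (y - x))) := by
      simp_rw [map_mul, ← hvz]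
      exact tendsto_comp_mul (fun m => (hπ _).trans (hkb m)) hk hk
    simpa [add_comp, comp_sub] using hlimx.add h1
  have hlim : ∀ (a : ℕ → A) (z : E →L[ℂ] E) (M : ℝ), (∀ m, 0 ≤ a m) → (∀ m, ‖a m‖ ≤ M) →
      IsSelfAdjoint z → spectrum ℝ z ⊆ Set.Ici 0 →
      Tendsto (fun m => π (a m) ∘L V) atTop (𝓝 (V ∘L z)) →
      Tendsto (fun m => adjoint V ∘L cfc f (π (a m)) ∘L V) atTop (𝓝 (cfc f z)) := by
    intro a z M ha hM hz hzσ hl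
    have hb : ∀ m, 0 ≤ π (a m) := fun m => map_nonneg π (ha m)
    have h1 := tendsto_comp_cfc (b := max M ‖z‖) (f := f) (fun m => (hπ _).trans (hM m))
      (fun m => (hb m).isSelfAdjoint) hz
      (fun m t ht => ⟨spectrum_nonneg_of_nonneg (hb m) ht,
        (le_abs_self t).trans <| (abs_le_norm_of_mem_spectrum ht).trans <|
          ((hπ _).trans (hM m)).trans (le_max_left _ _)⟩)
      (fun t ht => ⟨hzσ ht, (le_abs_self t).trans <|
        (abs_le_norm_of_mem_spectrum ht).trans (le_max_right _ _)⟩)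
      (hfc.mono Set.Icc_subset_Ici_self) hl
    have h2 := ((compL ℂ E H E (adjoint V)).continuous.tendsto _).comp h1
    have h3 : adjoint V ∘L (V ∘L cfc f z) = cfc f z := by
      rw [← comp_assoc, hiso]; ext; simp
    simpa [h3] using! h2
  refine le_of_tendsto_of_tendsto' (hlim _ x _ ha0 hab hx hxσ hlimx)
    (hlim _ y _ (fun m => add_nonneg (ha0 m) (hc0 m))
      (fun m => (norm_add_le _ _).trans (add_le_add (hab m) (hcb m))) hy hyσ hlimy) fun m => ?_
  have h1 := IsPositive.adjoint_conj (ContinuousLinearMap.le_def _ _ |>.1 (hmain m)) V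
  rw [ContinuousLinearMap.le_def]
  convert! h1 using 1
  simp [comp_sub, sub_comp]

end Compression

/-! ### Schur's lemma. -/

section Schur

variable {A H : Type*} [CStarAlgebra A] [NormedAddCommGroup H] [InnerProductSpace ℂ H]
  [CompleteSpace H] {π : A →⋆ₐ[ℂ] (H →L[ℂ] H)}

/-- The kernel of `S` is closed and invariant, and it contains the range of `T`. -/
theorem IsIrreducibleRep.eq_zero_or_eq_zero (hπ : IsIrreducibleRep π) {S T : H →L[ℂ] H}
    (hS : ∀ a, Commute S (π a)) (hST : S * T = 0) : S = 0 ∨ T = 0 := by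
  have hinv : ∀ a : A, ∀ x ∈ S.ker, π a x ∈ S.ker := by
    intro a x hx
    have h1 := congrArg (fun R : H →L[ℂ] H => R x) (hS a).eq
    simp only [mul_apply_eq_comp] at h1
    rw [LinearMap.mem_ker] at hx ⊢
    change S x = 0 at hx
    change S (π a x) = 0
    rw [h1, hx, map_zero]
  rcases hπ.2 S.ker S.isClosed_ker hinv with h | h
  · right
    ext x
    have h1 : T x ∈ S.ker := by
      have := congrArg (fun R : H →L[ℂ] H => R x) hST
      simpa using! this
    rw [h] at h1
    simpa using h1
  · left
    ext x
    have h1 : x ∈ S.ker := h ▸ Submodule.mem_top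
    simpa using! h1

theorem IsSelfAdjoint.exists_eq_algebraMap_of_subsingleton {B : Type*} [CStarAlgebra B]
    [Nontrivial B]
    {b : B} (hb : IsSelfAdjoint b) (h : (spectrum ℝ b).Subsingleton) :
    ∃ c : ℂ, b = algebraMap ℂ B c := by
  obtain ⟨c, hc⟩ := ContinuousFunctionalCalculus.spectrum_nonempty (R := ℝ) b hb
  refine ⟨(c : ℂ), ?_⟩
  have h1 : cfc (fun t : ℝ => t) b = cfc (fun _ => c) b := cfc_congr fun t ht => h ht hc
  rw [cfc_id' ℝ b, cfc_const c b] at h1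
  rw [h1, Algebra.algebraMap_eq_smul_one, Algebra.algebraMap_eq_smul_one, Complex.coe_smul]

theorem IsSelfAdjoint.exists_mul_eq_zero {B : Type*} [CStarAlgebra B]
    {b : B} (hb : IsSelfAdjoint b) (h : ¬ (spectrum ℝ b).Subsingleton) :
    ∃ f g : ℝ → ℝ, cfc f b * cfc g b = 0 ∧ cfc f b ≠ 0 ∧ cfc g b ≠ 0 := by
  rw [Set.not_subsingleton_iff] at h
  obtain ⟨s, hs, t, ht, hst⟩ := h.exists_lt
  have : Nontrivial B := by
    by_contra hB
    rw [not_nontrivial_iff_subsingleton] at hB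
    simp at hs
  -- The positive and negative parts of `r - m` have product zero, and each is nonzero at one of the
  -- two spectral points `s < m < t`.
  set m := (s + t) / 2 with hm
  have hne : ∀ f : ℝ → ℝ, Continuous f → ∀ r ∈ spectrum ℝ b, f r ≠ 0 → cfc f b ≠ 0 := by
    intro f hf r hr hfr h0
    have h1 : f r ∈ spectrum ℝ (cfc f b) := by
      rw [cfc_map_spectrum f b hb hf.continuousOn]
      exact Set.mem_image_of_mem f hr
    rw [h0, spectrum.zero_eq] at h1
    exact hfr h1
  have hf : Continuous fun r : ℝ => max 0 (r - m) := by fun_prop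
  have hg : Continuous fun r : ℝ => max 0 (m - r) := by fun_prop
  refine ⟨_, _, ?_, hne _ hf t ht ?_, hne _ hg s hs ?_⟩
  · rw [← cfc_mul _ _ b hf.continuousOn hg.continuousOn, ← cfc_const_zero ℝ b]
    refine cfc_congr fun r _ => ?_
    rcases le_total r m with h | h
    · simp [max_eq_left (sub_nonpos.2 h)]
    · simp [max_eq_left (sub_nonpos.2 h)]
  · exact (lt_max_of_lt_right (by linarith)).ne'
  · exact (lt_max_of_lt_right (by linarith)).ne'

/-- Schur's lemma: the commutant of an irreducible representation consists of scalars. -/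
theorem IsIrreducibleRep.exists_eq_algebraMap (hπ : IsIrreducibleRep π) {T : H →L[ℂ] H}
    (hT : ∀ a, Commute T (π a)) : ∃ c : ℂ, T = algebraMap ℂ (H →L[ℂ] H) c := by
  have := hπ.1
  have hsa : ∀ S : H →L[ℂ] H, IsSelfAdjoint S → (∀ a, Commute S (π a)) →
      ∃ c : ℂ, S = algebraMap ℂ (H →L[ℂ] H) c := by
    intro S hS hSc
    by_cases h : (spectrum ℝ S).Subsingleton
    · exact hS.exists_eq_algebraMap_of_subsingleton h
    · obtain ⟨f, g, h1, h2, h3⟩ := hS.exists_mul_eq_zero h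
      rcases hπ.eq_zero_or_eq_zero (fun a => (hSc a).cfc_real f) h1 with h | h
      · exact absurd h h2
      · exact absurd h h3
  have hstar : ∀ a, Commute (star T) (π a) := by
    intro a
    have := (hT (star a)).star_star
    rwa [map_star, star_star] at this
  obtain ⟨c, hc⟩ := hsa (T + star T) (IsSelfAdjoint.add_star_self T)
    fun a => (hT a).add_left (hstar a)
  obtain ⟨d, hd⟩ := hsa (Complex.I • (T - star T))
    (by rw [isSelfAdjoint_iff]; simp [star_smul, smul_sub]; abel)
    fun a => ((hT a).sub_left (hstar a)).smul_left _
  refine ⟨2⁻¹ * (c - Complex.I * d), ?_⟩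
  rw [map_mul, map_sub, map_mul, ← hc, ← hd, ← Algebra.smul_def, ← Algebra.smul_def, smul_smul,
    Complex.I_mul_I]
  module

end Schur

/-! ### The density theorem for irreducible representations, with self-adjoint approximants. -/

section Density

variable {A H : Type*} [CStarAlgebra A] [NormedAddCommGroup H] [InnerProductSpace ℂ H]
  [CompleteSpace H] {π : A →⋆ₐ[ℂ] (H →L[ℂ] H)} {ι : Type*} [Fintype ι]

/-- The operator acting as `T` in every component of a finite power of `H`. -/
noncomputable def diagonalOp (ι : Type*) [Fintype ι] {H : Type*} [NormedAddCommGroup H]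
    [InnerProductSpace ℂ H] (T : H →L[ℂ] H) :
    PiLp 2 (fun _ : ι => H) →L[ℂ] PiLp 2 (fun _ : ι => H) :=
  ((PiLp.continuousLinearEquiv 2 ℂ fun _ : ι => H).symm : (ι → H) →L[ℂ] _) ∘L
    ContinuousLinearMap.pi (fun i => T ∘L ContinuousLinearMap.proj i) ∘L
    (PiLp.continuousLinearEquiv 2 ℂ fun _ : ι => H : _ →L[ℂ] (ι → H))

omit [CompleteSpace H] in
@[simp]
theorem diagonalOp_apply (T : H →L[ℂ] H) (z : PiLp 2 (fun _ : ι => H)) (i : ι) :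
    diagonalOp ι T z i = T (z i) := rfl

theorem inner_diagonalOp (T : H →L[ℂ] H) (y z : PiLp 2 (fun _ : ι => H)) :
    inner ℂ y (diagonalOp ι T z) = inner ℂ (diagonalOp ι (star T) y) z := by
  simp [PiLp.inner_apply, star_eq_adjoint, adjoint_inner_left]

/-- An operator on a finite power of `H` commuting with the diagonal action of an irreducible
representation has scalar entries, so it commutes with all diagonal operators. -/
theorem IsIrreducibleRep.diagonalOp_comm (hπ : IsIrreducibleRep π)
    {P : PiLp 2 (fun _ : ι => H) →L[ℂ] PiLp 2 (fun _ : ι => H)}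
    (hP : ∀ a z, P (diagonalOp ι (π a) z) = diagonalOp ι (π a) (P z))
    (T : H →L[ℂ] H) (z : PiLp 2 (fun _ : ι => H)) :
    P (diagonalOp ι T z) = diagonalOp ι T (P z) := by
  classical
  let Q : ι → ι → H →L[ℂ] H := fun i j =>
    (PiLp.proj 2 (fun _ : ι => H) i : _ →L[ℂ] H) ∘L P ∘L
      ((PiLp.continuousLinearEquiv 2 ℂ fun _ : ι => H).symm : (ι → H) →L[ℂ] _) ∘L
      (ContinuousLinearMap.single ℂ (fun _ : ι => H) j)
  have hQ : ∀ i j x, Q i j x = P (PiLp.single 2 j x) i := fun i j x => rfl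
  have hsum : ∀ z : PiLp 2 (fun _ : ι => H), ∀ i, P z i = ∑ j, Q i j (z j) := by
    intro z i
    have hz : z = ∑ j, PiLp.single 2 j (z j) := by
      ext k
      simp [Pi.single_apply]
    conv_lhs => rw [hz, map_sum]
    simp [hQ]
  have hsingle : ∀ (S : H →L[ℂ] H) j x,
      PiLp.single 2 j (S x) = diagonalOp ι S (PiLp.single 2 j x) := by
    intro S j x
    ext k
    by_cases h : k = j
    · subst h; simp
    · simp [h]
  have hcomm : ∀ i j a, Commute (Q i j) (π a) := by
    intro i j a
    ext x
    simp only [mul_apply_eq_comp, hQ]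
    rw [hsingle, hP, diagonalOp_apply]
  choose c hc using fun i j => hπ.exists_eq_algebraMap (hcomm i j)
  ext i
  rw [diagonalOp_apply, hsum, hsum, map_sum]
  refine Finset.sum_congr rfl fun j _ => ?_
  rw [hc, diagonalOp_apply]
  simp [Algebra.algebraMap_eq_smul_one]

/-- The projection onto the closure of `{π(a) x}` in the finite power of `H` commutes with the
diagonal action of `A`, hence with that of `T` by Schur's lemma. Since `x` lies in this closure
(take `a = 1`), so does `T x`. -/
theorem IsIrreducibleRep.exists_approx (hπ : IsIrreducibleRep π) (T : H →L[ℂ] H) (x : ι → H)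
    {ε : ℝ} (hε : 0 < ε) : ∃ a : A, ∀ i, ‖π a (x i) - T (x i)‖ < ε := by
  let x' : PiLp 2 (fun _ : ι => H) := WithLp.toLp 2 x
  let L : A →ₗ[ℂ] PiLp 2 (fun _ : ι => H) :=
    { toFun := fun a => diagonalOp ι (π a) x'
      map_add' := fun a b => by ext i; simp
      map_smul' := fun c a => by ext i; simp }
  let M := L.range.topologicalClosure
  have : CompleteSpace M := L.range.isClosed_topologicalClosure.completeSpace_coe
  have hL : ∀ a, L a ∈ M := fun a => L.range.le_topologicalClosure ⟨a, rfl⟩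
  have hM : ∀ a, ∀ z ∈ M, diagonalOp ι (π a) z ∈ M := by
    intro a z hz
    refine map_mem_closure (diagonalOp ι (π a)).continuous hz ?_
    rintro _ ⟨b, rfl⟩
    refine ⟨a * b, ?_⟩
    ext i
    simp [L]
  have hMo : ∀ a, ∀ z ∈ Mᗮ, diagonalOp ι (π a) z ∈ Mᗮ := by
    intro a z hz y hy
    rw [inner_diagonalOp, ← map_star]
    exact hz _ (hM _ _ hy)
  have hP : ∀ a z, M.starProjection (diagonalOp ι (π a) z) =
      diagonalOp ι (π a) (M.starProjection z) := by
    intro a z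
    refine Submodule.eq_starProjection_of_mem_orthogonal
      (hM a _ (Submodule.starProjection_apply_mem M z)) ?_
    rw [← map_sub]
    exact hMo a _ (Submodule.sub_starProjection_mem_orthogonal z)
  have hx' : x' ∈ M := by
    have h := hL 1
    have h1 : L 1 = x' := by ext i; simp [L]
    rwa [h1] at h
  have hT : diagonalOp ι T x' ∈ M := by
    have h := hπ.diagonalOp_comm hP T x'
    rw [Submodule.starProjection_eq_self_iff.2 hx'] at h
    rw [← Submodule.starProjection_eq_self_iff, h]
  obtain ⟨_, ⟨a, rfl⟩, ha⟩ := Metric.mem_closure_iff.1 hT ε hε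
  refine ⟨a, fun i => ?_⟩
  rw [dist_eq_norm, norm_sub_rev] at ha
  exact (PiLp.norm_apply_le (L a - diagonalOp ι T x') i).trans_lt ha

/-- This is the double orthogonal complement in the underlying real Hilbert space; a real version is
needed because self-adjoint elements form only a real subspace. -/
theorem exists_re_inner_ne_zero {K : Type*} [NormedAddCommGroup K] [InnerProductSpace ℂ K]
    [CompleteSpace K] (R : Submodule ℝ K) {y : K} (hy : y ∉ closure (R : Set K)) :
    ∃ ζ : K, (∀ r ∈ R, (inner ℂ ζ r).re = 0) ∧ (inner ℂ ζ y).re ≠ 0 := by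
  let : InnerProductSpace ℝ K := InnerProductSpace.complexToReal
  have : CompleteSpace R.topologicalClosure := R.isClosed_topologicalClosure.completeSpace_coe
  have h1 : y ∉ R.topologicalClosure := hy
  rw [← Submodule.orthogonal_orthogonal R.topologicalClosure, Submodule.mem_orthogonal] at h1
  push Not at h1
  obtain ⟨ζ, hζ, hne⟩ := h1
  refine ⟨ζ, fun r hr => ?_, hne⟩
  have h2 := hζ r (R.le_topologicalClosure hr)
  rw [real_inner_comm] at h2
  exact h2

/-- If `T x` were not a limit, some `ζ` would be real-orthogonal to all `π(h) x` with `h`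
self-adjoint, but not to `T x`. Symmetrizing in `ζ` and `x` gives a complex-linear `F` that equals
twice the real pairing on self-adjoint operators. It vanishes on `π(A)`, and by density at the
vectors `x` and `ζ` simultaneously it also vanishes at `T`. -/
theorem IsIrreducibleRep.exists_selfAdjoint_approx (hπ : IsIrreducibleRep π) {T : H →L[ℂ] H}
    (hT : IsSelfAdjoint T) (x : ι → H) {ε : ℝ} (hε : 0 < ε) :
    ∃ h : A, IsSelfAdjoint h ∧ ∀ i, ‖π h (x i) - T (x i)‖ < ε := by
  let x' : PiLp 2 (fun _ : ι => H) := WithLp.toLp 2 x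
  let R : Submodule ℝ (PiLp 2 (fun _ : ι => H)) :=
    { carrier := {z | ∃ h : A, IsSelfAdjoint h ∧ diagonalOp ι (π h) x' = z}
      add_mem' := by
        rintro _ _ ⟨h, hh, rfl⟩ ⟨k, hk, rfl⟩
        exact ⟨h + k, hh.add hk, by ext i; simp⟩
      zero_mem' := ⟨0, IsSelfAdjoint.zero A, by ext i; simp⟩
      smul_mem' := by
        rintro r _ ⟨h, hh, rfl⟩
        refine ⟨(r : ℂ) • h, IsSelfAdjoint.smul (Complex.conj_ofReal r) hh, ?_⟩
        ext i
        rw [map_smul, diagonalOp_apply, smul_apply, Complex.coe_smul]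
        rfl }
  suffices hmem : diagonalOp ι T x' ∈ closure (R : Set (PiLp 2 (fun _ : ι => H))) by
    obtain ⟨_, ⟨h, hh, rfl⟩, hd⟩ := Metric.mem_closure_iff.1 hmem ε hε
    refine ⟨h, hh, fun i => ?_⟩
    rw [dist_eq_norm, norm_sub_rev] at hd
    exact (PiLp.norm_apply_le (diagonalOp ι (π h) x' - diagonalOp ι T x') i).trans_lt hd
  by_contra hmem
  obtain ⟨ζ, hζ, hne⟩ := exists_re_inner_ne_zero R hmem
  let F : (H →L[ℂ] H) →ₗ[ℂ] ℂ :=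
    { toFun := fun S => ∑ i, (inner ℂ (ζ i) (S (x i)) + inner ℂ (x i) (S (ζ i)))
      map_add' := fun S S' => by
        rw [← Finset.sum_add_distrib]
        refine Finset.sum_congr rfl fun i _ => ?_
        simp only [add_apply, inner_add_right]; ring
      map_smul' := fun c S => by
        simp [Finset.mul_sum, mul_add] }
  have hFsa : ∀ S : H →L[ℂ] H, IsSelfAdjoint S →
      F S = (2 * (inner ℂ ζ (diagonalOp ι S x')).re : ℝ) := by
    intro S hS
    have h1 : ∀ i, inner ℂ (ζ i) (S (x i)) + inner ℂ (x i) (S (ζ i)) =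
        ((2 * (inner ℂ (ζ i) (S (x i))).re : ℝ) : ℂ) := by
      intro i
      have h2 : inner ℂ (x i) (S (ζ i)) = (starRingEnd ℂ) (inner ℂ (ζ i) (S (x i))) := by
        rw [inner_conj_symm]
        conv_lhs => rw [← hS.star_eq, star_eq_adjoint, adjoint_inner_right]
      rw [h2, Complex.add_conj]
    change ∑ i, _ = _
    simp_rw [h1]
    rw [← Complex.ofReal_sum, ← Finset.mul_sum, PiLp.inner_apply, Complex.re_sum]
    rfl
  have hFA : ∀ a : A, F (π a) = 0 := by
    have hs : ∀ h : A, IsSelfAdjoint h → F (π h) = 0 := by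
      intro h hh
      rw [hFsa _ (hh.map π), hζ _ ⟨h, hh, rfl⟩]
      simp
    intro a
    rw [← realPart_add_I_smul_imaginaryPart a, map_add, map_add, map_smul, map_smul,
      hs _ (realPart a).2, hs _ (imaginaryPart a).2]
    simp
  have hFT : F T = 0 := by
    have hbound : ∀ δ : ℝ, 0 < δ → ‖F T‖ ≤ δ * ∑ i, (‖ζ i‖ + ‖x i‖) := by
      intro δ hδ
      obtain ⟨a, ha⟩ := hπ.exists_approx T (Sum.elim x (fun i => ζ i)) hδ
      have h1 : F T = - F (π a - T) := by rw [map_sub, hFA]; ring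
      rw [h1, norm_neg, Finset.mul_sum]
      refine (norm_sum_le _ _).trans (Finset.sum_le_sum fun i _ => (norm_add_le _ _).trans ?_)
      have h2 := (ha (Sum.inl i)).le
      have h3 := (ha (Sum.inr i)).le
      have h4 := norm_inner_le_norm (𝕜 := ℂ) (ζ i) ((π a - T) (x i))
      have h5 := norm_inner_le_norm (𝕜 := ℂ) (x i) ((π a - T) (ζ i))
      simp only [Sum.elim_inl, Sum.elim_inr, sub_apply] at h2 h3 h4 h5 ⊢
      nlinarith [norm_nonneg (ζ i), norm_nonneg (x i)]
    by_contra hF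
    have h0 : 0 < ‖F T‖ := norm_pos_iff.2 hF
    set S := ∑ i, (‖ζ i‖ + ‖x i‖) with hS
    have hS0 : 0 ≤ S := Finset.sum_nonneg fun i _ => by positivity
    have h1 := hbound (‖F T‖ / (2 * (S + 1))) (by positivity)
    rw [div_mul_eq_mul_div, le_div_iff₀ (by positivity)] at h1
    nlinarith
  rw [hFsa T hT] at hFT
  apply hne
  have := Complex.ofReal_eq_zero.1 hFT
  linarith

theorem IsIrreducibleRep.approximatesSelfAdjoint (hπ : IsIrreducibleRep π)
    {V : EuclideanSpace ℂ ι →L[ℂ] H} (hV : adjoint V ∘L V = 1) : ApproximatesSelfAdjoint π V := by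
  classical
  intro u hu
  have hT : IsSelfAdjoint (V ∘L u ∘L adjoint V) := hu.conj_adjoint V
  have hVV : ∀ x, adjoint V (V x) = x := fun x => by
    have := congrArg (fun S : EuclideanSpace ℂ ι →L[ℂ] EuclideanSpace ℂ ι => S x) hV
    simpa using! this
  choose h hs ha using fun m : ℕ => hπ.exists_selfAdjoint_approx hT
    (fun i : ι => V (EuclideanSpace.single i 1)) (ε := 1 / ((m : ℝ) + 1)) (by positivity)
  refine ⟨h, hs, ?_⟩
  rw [tendsto_iff_norm_sub_tendsto_zero]
  have hlim : Tendsto (fun m : ℕ => (Fintype.card ι : ℝ) * (1 / ((m : ℝ) + 1))) atTop (𝓝 0) := by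
    simpa using! tendsto_one_div_add_atTop_nhds_zero_nat.const_mul (Fintype.card ι : ℝ)
  refine squeeze_zero (fun _ => norm_nonneg _) (fun m => ?_) hlim
  refine opNorm_le_bound _ (by positivity) fun z => ?_
  have hz : z = ∑ i, z i • EuclideanSpace.single i (1 : ℂ) := by
    ext k
    simp [Pi.single_apply]
  have h1 : (π (h m) ∘L V - V ∘L u) z =
      ∑ i, z i • (π (h m) ∘L V - V ∘L u) (EuclideanSpace.single i (1 : ℂ)) := by
    conv_lhs => rw [hz, map_sum]
    simp only [map_smul]
  rw [h1]
  calc _ ≤ ∑ i, ‖z i • (π (h m) ∘L V - V ∘L u) (EuclideanSpace.single i (1 : ℂ))‖ :=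
        norm_sum_le _ _
    _ ≤ ∑ _i : ι, ‖z‖ * (1 / ((m : ℝ) + 1)) := by
        refine Finset.sum_le_sum fun i _ => ?_
        rw [norm_smul]
        refine mul_le_mul (PiLp.norm_apply_le z i) ?_ (norm_nonneg _) (norm_nonneg _)
        have := (ha m i).le
        simpa [hVV] using this
    _ = _ := by rw [Finset.sum_const, Finset.card_univ, nsmul_eq_mul]; ring

end Density

/-! ### Pure states, the GNS construction and detection of positivity. -/

section Representations

open scoped ComplexOrder

section States

variable {A : Type*} [CStarAlgebra A] [PartialOrder A]

/-- The state space of `A`: states are given by their restrictions to the self-adjoint part. -/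
def selfAdjointStates (A : Type*) [CStarAlgebra A] [PartialOrder A] :
    Set (WeakDual ℝ (selfAdjoint A)) :=
  {φ | φ 1 = 1 ∧ ∀ a : selfAdjoint A, 0 ≤ (a : A) → 0 ≤ φ a}

/-- The set of states taking their least value at `a`. -/
def minimalStates (a : selfAdjoint A) : Set (WeakDual ℝ (selfAdjoint A)) :=
  {φ ∈ selfAdjointStates A | ∀ ψ ∈ selfAdjointStates A, φ a ≤ ψ a}

variable [StarOrderedRing A]

/-- The bound comes from `-‖a‖ ≤ a ≤ ‖a‖`. -/
theorem abs_apply_le_of_nonneg {φ : selfAdjoint A →ₗ[ℝ] ℝ}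
    (hφ : ∀ a : selfAdjoint A, 0 ≤ (a : A) → 0 ≤ φ a) (a : selfAdjoint A) :
    |φ a| ≤ φ 1 * ‖a‖ := by
  have h1 := hφ (‖a‖ • 1 - a) (by
    have := IsSelfAdjoint.le_algebraMap_norm_self (ha := a.2)
    rw [Algebra.algebraMap_eq_smul_one, ← sub_nonneg] at this
    simpa using! this)
  have h2 := hφ (‖a‖ • 1 + a) (by
    have := IsSelfAdjoint.neg_algebraMap_norm_le_self (ha := a.2)
    rw [Algebra.algebraMap_eq_smul_one] at this
    have := sub_nonneg.2 this
    rw [sub_neg_eq_add, add_comm] at this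
    simpa using! this)
  rw [map_sub, map_smul, smul_eq_mul] at h1
  rw [map_add, map_smul, smul_eq_mul] at h2
  rw [abs_le]
  constructor <;> linarith

theorem isCompact_selfAdjointStates : IsCompact (selfAdjointStates A) := by
  have hcl : IsClosed (selfAdjointStates A) := by
    have h1 : selfAdjointStates A = {φ | φ 1 = 1} ∩
        ⋂ (a : selfAdjoint A) (_ : 0 ≤ (a : A)), {φ : WeakDual ℝ (selfAdjoint A) | 0 ≤ φ a} := by
      ext φ
      simp [selfAdjointStates]
    rw [h1]
    refine (isClosed_eq (WeakDual.eval_continuous 1) continuous_const).inter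
      (isClosed_iInter fun a => isClosed_iInter fun _ =>
        isClosed_le continuous_const (WeakDual.eval_continuous a))
  refine (WeakDual.isCompact_closedBall (𝕜 := ℝ) (0 : StrongDual ℝ (selfAdjoint A))
    1).of_isClosed_subset hcl
    fun φ hφ => ?_
  refine (mem_closedBall_zero_iff (E := StrongDual ℝ (selfAdjoint A))).2 ?_
  refine opNorm_le_bound _ zero_le_one fun a => ?_
  have := abs_apply_le_of_nonneg (φ := (φ.toStrongDual : selfAdjoint A →L[ℝ] ℝ).toLinearMap) hφ.2 a
  have h1 : φ 1 = 1 := hφ.1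
  change |φ a| ≤ φ 1 * ‖a‖ at this
  rw [h1] at this
  exact this

theorem exists_state_apply_neg {a : selfAdjoint A} (ha : ¬ 0 ≤ (a : A)) :
    ∃ φ ∈ selfAdjointStates A, φ a < 0 := by
  have hconv : Convex ℝ {b : selfAdjoint A | 0 ≤ (b : A)} := by
    intro b hb c hc s t hs ht _
    have : 0 ≤ s • (b : A) + t • (c : A) := add_nonneg (smul_nonneg hs hb) (smul_nonneg ht hc)
    simpa using this
  have hclosed : IsClosed {b : selfAdjoint A | 0 ≤ (b : A)} :=
    isClosed_le continuous_const continuous_subtype_val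
  obtain ⟨f, u, hfa, hfb⟩ := geometric_hahn_banach_point_closed hconv hclosed ha
  have hu : u < 0 := by simpa using hfb 0 (by simp)
  have hpos : ∀ b : selfAdjoint A, 0 ≤ (b : A) → 0 ≤ f b := by
    intro b hb
    by_contra hlt
    push Not at hlt
    -- A negative value on the cone could be rescaled to equal `u`, contradicting strict separation.
    have h1 := hfb ((u / f b) • b) (by
      have : 0 ≤ (u / f b) • (b : A) := smul_nonneg (div_nonneg_of_nonpos hu.le hlt.le) hb
      simpa using this)
    rw [map_smul, smul_eq_mul, div_mul_cancel₀ _ hlt.ne] at h1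
    exact lt_irrefl _ h1
  have habs := abs_apply_le_of_nonneg (φ := f.toLinearMap) hpos a
  have h1 : 0 < f 1 := by
    have h0 : 0 < |f a| := abs_pos.2 (by linarith)
    have h2 : 0 < f 1 * ‖a‖ := h0.trans_le habs
    exact pos_of_mul_pos_left h2 (norm_nonneg a)
  refine ⟨StrongDual.toWeakDual ((f 1)⁻¹ • f), ⟨?_, fun b hb => ?_⟩, ?_⟩
  · change (f 1)⁻¹ * f 1 = 1
    exact inv_mul_cancel₀ h1.ne'
  · change 0 ≤ (f 1)⁻¹ * f b
    exact mul_nonneg (inv_nonneg.2 h1.le) (hpos b hb)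
  · change (f 1)⁻¹ * f a < 0
    exact mul_neg_of_pos_of_neg (inv_pos.2 h1) (by linarith)

/-- The minimal value at `a` is attained by compactness, and the existence part of Krein–Milman is
applied to the set of minimizers, so the extreme point stays negative at `a`. -/
theorem exists_extreme_state_apply_neg {a : selfAdjoint A} (ha : ¬ 0 ≤ (a : A)) :
    ∃ φ ∈ (minimalStates a).extremePoints ℝ, φ a < 0 := by
  obtain ⟨ψ, hψ, hψa⟩ := exists_state_apply_neg ha
  obtain ⟨χ, hχ, hmin⟩ := isCompact_selfAdjointStates.exists_isMinOn ⟨ψ, hψ⟩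
    (WeakDual.eval_continuous a).continuousOn
  have hne : (minimalStates a).Nonempty := ⟨χ, hχ, fun ξ hξ => hmin hξ⟩
  have heq : minimalStates a = selfAdjointStates A ∩ {φ | φ a ≤ χ a} := by
    ext φ
    exact ⟨fun h => ⟨h.1, h.2 χ hχ⟩, fun h => ⟨h.1, fun ξ hξ => h.2.trans (hmin hξ)⟩⟩
  have hcomp : IsCompact (minimalStates a) := by
    rw [heq]
    exact isCompact_selfAdjointStates.inter_right
      (isClosed_le (WeakDual.eval_continuous a) continuous_const)
  have : LocallyConvexSpace ℝ (WeakDual ℝ (selfAdjoint A)) :=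
    inferInstanceAs (LocallyConvexSpace ℝ (WeakBilin (topDualPairing ℝ (selfAdjoint A))))
  obtain ⟨φ, hφ⟩ := hcomp.extremePoints_nonempty hne
  exact ⟨φ, hφ, (hφ.1.2 ψ hψ).trans_lt hψa⟩

/-- The complex-linear extension of a state. -/
noncomputable def WeakDual.toPositiveLinearMap (φ : WeakDual ℝ (selfAdjoint A))
    (hφ : φ ∈ selfAdjointStates A) : A →ₚ[ℂ] ℂ :=
  PositiveLinearMap.mk₀
    { toFun := fun x => (φ (realPart x) : ℂ) + Complex.I * φ (imaginaryPart x)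
      map_add' := fun x y => by simp only [map_add]; push_cast; ring
      map_smul' := fun c x => by
        rw [realPart_smul, imaginaryPart_smul]
        simp only [map_add, map_sub, map_smul, RingHom.id_apply, smul_eq_mul]
        push_cast
        conv_rhs => rw [← Complex.re_add_im c]
        ring_nf
        rw [Complex.I_sq]
        ring }
    fun x hx => by
      have h1 : imaginaryPart x = 0 := (IsSelfAdjoint.of_nonneg hx).imaginaryPart
      have h2 : (realPart x : A) = x := (IsSelfAdjoint.of_nonneg hx).coe_realPart
      simp only [LinearMap.coe_mk, AddHom.coe_mk, h1, map_zero, Complex.ofReal_zero, mul_zero,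
        add_zero]
      rw [Complex.zero_le_real]
      exact hφ.2 _ (by rw [h2]; exact hx)

theorem WeakDual.toPositiveLinearMap_apply (φ : WeakDual ℝ (selfAdjoint A))
    (hφ : φ ∈ selfAdjointStates A) (a : selfAdjoint A) :
    φ.toPositiveLinearMap hφ (a : A) = φ a := by
  change (φ (realPart (a : A)) : ℂ) + Complex.I * φ (imaginaryPart (a : A)) = φ a
  simp

end States

section PureStates

variable {A H : Type*} [CStarAlgebra A] [PartialOrder A] [StarOrderedRing A]
  [NormedAddCommGroup H] [InnerProductSpace ℂ H] [CompleteSpace H] {π : A →⋆ₐ[ℂ] (H →L[ℂ] H)}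

/-- The functional `b ↦ ⟪ξ, π b ξ⟫` on the self-adjoint part. -/
noncomputable def vectorFunctional (π : A →⋆ₐ[ℂ] (H →L[ℂ] H)) (ξ : H) :
    WeakDual ℝ (selfAdjoint A) :=
  StrongDual.toWeakDual <| LinearMap.mkContinuous
    { toFun := fun b => (inner ℂ ξ (π (b : A) ξ)).re
      map_add' := fun b c => by simp
      map_smul' := fun r b => by
        have h : ((r • b : selfAdjoint A) : A) = (r : ℂ) • (b : A) := by simp
        rw [h, map_smul, smul_apply, inner_smul_right, Complex.re_ofReal_mul]
        rfl }
    (‖ξ‖ ^ 2) fun b => by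
      change ‖(inner ℂ ξ (π (b : A) ξ)).re‖ ≤ _
      calc _ ≤ ‖inner ℂ ξ (π (b : A) ξ)‖ := Complex.abs_re_le_norm _
        _ ≤ ‖ξ‖ * ‖π (b : A) ξ‖ := norm_inner_le_norm _ _
        _ ≤ ‖ξ‖ * (‖(b : A)‖ * ‖ξ‖) := by
          gcongr
          exact (le_opNorm _ _).trans (by gcongr; exact StarAlgHom.norm_apply_le' π _)
        _ = ‖ξ‖ ^ 2 * ‖b‖ := by rw [AddSubgroup.coe_norm]; ring

theorem vectorFunctional_apply (ξ : H) (b : selfAdjoint A) :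
    vectorFunctional π ξ b = (inner ℂ ξ (π (b : A) ξ)).re := rfl

theorem inv_smul_vectorFunctional_mem {ξ : H} (hξ : ξ ≠ 0) :
    (‖ξ‖ ^ 2)⁻¹ • vectorFunctional π ξ ∈ selfAdjointStates A := by
  have h0 : ‖ξ‖ ^ 2 ≠ 0 := by simpa using hξ
  constructor
  · change (‖ξ‖ ^ 2)⁻¹ * (inner ℂ ξ (π ((1 : selfAdjoint A) : A) ξ)).re = 1
    rw [selfAdjoint.val_one, map_one, one_apply_eq_self]
    have := inner_self_eq_norm_sq (𝕜 := ℂ) ξ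
    change (inner ℂ ξ ξ).re = ‖ξ‖ ^ 2 at this
    rw [this, inv_mul_cancel₀ h0]
  · intro b hb
    change 0 ≤ (‖ξ‖ ^ 2)⁻¹ * (inner ℂ ξ (π (b : A) ξ)).re
    have h1 : 0 ≤ π (b : A) := map_nonneg π hb
    rw [nonneg_iff_isPositive] at h1
    exact mul_nonneg (by positivity) (h1.re_inner_nonneg_right ξ)

/-- Self-adjoint elements span `A` over `ℂ`, and the orbit of `Ω` is dense. -/
theorem eq_of_forall_inner_cyclic {Ω ξ η : H} (hΩ : DenseRange fun a : A => π a Ω)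
    (h : ∀ b : A, IsSelfAdjoint b → inner ℂ ξ (π b Ω) = inner ℂ η (π b Ω)) : ξ = η := by
  have hall : ∀ b : A, inner ℂ ξ (π b Ω) = inner ℂ η (π b Ω) := by
    intro b
    rw [← realPart_add_I_smul_imaginaryPart b, map_add, map_smul, add_apply, smul_apply,
      inner_add_right, inner_add_right, inner_smul_right, inner_smul_right,
      h _ (realPart b).2, h _ (imaginaryPart b).2]
  refine ext_inner_right ℂ fun v => ?_
  exact congrFun (hΩ.equalizer (g := fun v => inner ℂ ξ v) (h := fun v => inner ℂ η v)
    (by fun_prop) (by fun_prop) (funext hall)) v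

/-- The projection `P` onto an invariant subspace commutes with `π(A)` and splits the state into the
vector states of `P Ω` and `Ω - P Ω`. If both vectors are nonzero, extremality identifies the first
normalized part with the whole state, whence `P Ω = t Ω` with `0 < t < 1`, which contradicts `P² =
P`. -/
theorem isIrreducibleRep_of_extreme {Ω : H} (hΩ : DenseRange fun a : A => π a Ω)
    (hΩ1 : ‖Ω‖ = 1) {a : selfAdjoint A}
    (hext : vectorFunctional π Ω ∈ (minimalStates a).extremePoints ℝ) : IsIrreducibleRep π := by
  have hΩ0 : Ω ≠ 0 := by rintro rfl; simp at hΩ1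
  refine ⟨⟨Ω, 0, hΩ0⟩, fun K hK hinv => ?_⟩
  have : CompleteSpace K := hK.completeSpace_coe
  set P := K.starProjection with hP
  have hcomm : ∀ b z, P (π b z) = π b (P z) := by
    intro b z
    refine Submodule.eq_starProjection_of_mem_orthogonal
      (hinv b _ (Submodule.starProjection_apply_mem K z)) ?_
    rw [← map_sub]
    intro y hy
    rw [← adjoint_inner_left, ← star_eq_adjoint, ← map_star]
    exact Submodule.sub_starProjection_mem_orthogonal z _ (hinv _ _ hy)
  have hPP : ∀ z, P (P z) = P z := fun z =>
    Submodule.starProjection_eq_self_iff.2 (Submodule.starProjection_apply_mem K z)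
  have hsymm : ∀ y z, inner ℂ (P y) z = inner ℂ y (P z) :=
    fun y z => Submodule.inner_starProjection_left_eq_right K y z
  have hdense : ∀ {S : H →L[ℂ] H} (R : H →L[ℂ] H), (∀ b : A, S (π b Ω) = R (π b Ω)) → S = R := by
    intro S R h
    ext v
    exact congrFun (hΩ.equalizer S.continuous R.continuous (funext h)) v
  by_cases h0 : P Ω = 0
  · left
    have h1 : P = 0 := hdense 0 fun b => by rw [hcomm, h0]; simp
    rw [eq_bot_iff]
    intro x hx
    have := Submodule.starProjection_eq_self_iff.2 hx
    rw [← hP, h1] at this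
    simpa using this.symm
  by_cases h1 : Ω - P Ω = 0
  · right
    have h2 : P = 1 := hdense 1 fun b => by rw [hcomm, ← sub_eq_zero.1 h1]; simp
    rw [eq_top_iff]
    intro x _
    rw [← Submodule.starProjection_eq_self_iff, ← hP, h2]
    simp
  exfalso
  set t := ‖P Ω‖ ^ 2 with ht
  set s := ‖Ω - P Ω‖ ^ 2 with hs
  have ht0 : 0 < t := by have := norm_pos_iff.2 h0; positivity
  have hs0 : 0 < s := by have := norm_pos_iff.2 h1; positivity
  have hsplit : vectorFunctional π Ω =
      t • (t⁻¹ • vectorFunctional π (P Ω)) + s • (s⁻¹ • vectorFunctional π (Ω - P Ω)) := by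
    rw [smul_smul, smul_smul, mul_inv_cancel₀ ht0.ne', mul_inv_cancel₀ hs0.ne', one_smul, one_smul]
    refine DFunLike.ext _ _ fun b => ?_
    change (inner ℂ Ω (π (b : A) Ω)).re = (inner ℂ (P Ω) (π (b : A) (P Ω))).re +
      (inner ℂ (Ω - P Ω) (π (b : A) (Ω - P Ω))).re
    rw [← Complex.add_re]
    congr 1
    simp only [map_sub, inner_sub_left, inner_sub_right, hsymm, ← hcomm, hPP]
    ring
  have hst : t + s = 1 := by
    have h2 := inner_self_eq_norm_sq (𝕜 := ℂ) Ω
    have h3 := inner_self_eq_norm_sq (𝕜 := ℂ) (P Ω)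
    have h4 := inner_self_eq_norm_sq (𝕜 := ℂ) (Ω - P Ω)
    rw [hΩ1] at h2
    rw [ht, hs, ← h3, ← h4, ← map_add]
    rw [one_pow] at h2
    rw [← h2]
    congr 1
    simp only [inner_sub_left, inner_sub_right, hsymm, hPP]
    ring
  have hm1 := inv_smul_vectorFunctional_mem (π := π) h0
  have hm2 := inv_smul_vectorFunctional_mem (π := π) h1
  rw [← ht] at hm1
  rw [← hs] at hm2
  have hval : vectorFunctional π Ω a = t * (t⁻¹ • vectorFunctional π (P Ω)) a +
      s * (s⁻¹ • vectorFunctional π (Ω - P Ω)) a := by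
    conv_lhs => rw [hsplit]
    rfl
  have hl1 := hext.1.2 _ hm1
  have hl2 := hext.1.2 _ hm2
  have hone : t * vectorFunctional π Ω a + s * vectorFunctional π Ω a = vectorFunctional π Ω a := by
    rw [← add_mul, hst, one_mul]
  -- The minimizers form a face: two states whose proper convex combination attains the minimum at
  -- `a` both attain it.
  have hmin1 : t⁻¹ • vectorFunctional π (P Ω) ∈ minimalStates a := by
    refine ⟨hm1, fun ψ hψ => le_trans ?_ (hext.1.2 ψ hψ)⟩
    have := mul_le_mul_of_nonneg_left hl2 hs0.le
    refine le_of_mul_le_mul_left ?_ ht0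
    linarith
  have hmin2 : s⁻¹ • vectorFunctional π (Ω - P Ω) ∈ minimalStates a := by
    refine ⟨hm2, fun ψ hψ => le_trans ?_ (hext.1.2 ψ hψ)⟩
    have := mul_le_mul_of_nonneg_left hl1 ht0.le
    refine le_of_mul_le_mul_left ?_ hs0
    linarith
  have heq : t⁻¹ • vectorFunctional π (P Ω) = vectorFunctional π Ω :=
    hext.2 hmin1 hmin2 ⟨t, s, ht0, hs0, hst, hsplit.symm⟩
  have hPΩ : P Ω = (t : ℂ) • Ω := by
    refine eq_of_forall_inner_cyclic hΩ fun b hb => ?_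
    have h2 := congrArg (fun φ : WeakDual ℝ (selfAdjoint A) => φ ⟨b, hb⟩) heq
    change t⁻¹ * (inner ℂ (P Ω) (π b (P Ω))).re = (inner ℂ Ω (π b Ω)).re at h2
    have hreal : ∀ ξ : H, (inner ℂ ξ (π b ξ)).im = 0 := by
      intro ξ
      have h3 : (starRingEnd ℂ) (inner ℂ ξ (π b ξ)) = inner ℂ ξ (π b ξ) := by
        rw [inner_conj_symm]
        conv_lhs => rw [← adjoint_inner_right, ← star_eq_adjoint, ← map_star, hb.star_eq]
      exact Complex.conj_eq_iff_im.1 h3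
    have h3 : inner ℂ (P Ω) (π b Ω) = inner ℂ (P Ω) (π b (P Ω)) := by
      rw [← hcomm, ← hsymm, hPP]
    rw [h3, inner_smul_left, Complex.conj_ofReal]
    apply Complex.ext
    · rw [Complex.re_ofReal_mul, ← h2, mul_inv_cancel_left₀ ht0.ne']
    · rw [Complex.im_ofReal_mul, hreal, hreal, mul_zero]
  have h2 := hPP Ω
  rw [hPΩ, map_smul, hPΩ, smul_smul, ← sub_eq_zero, ← sub_smul, smul_eq_zero,
    or_iff_left hΩ0] at h2
  have h3 : t * t - t = 0 := by exact_mod_cast h2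
  have h4 : t * s = 0 := by rw [← sub_eq_iff_eq_add'.2 hst.symm]; linarith
  exact (mul_pos ht0 hs0).ne' h4

end PureStates

/-- The GNS space is a completion built from `A`, so it stays in the universe of `A`, as `irrepDims`
requires. -/
theorem exists_isIrreducibleRep_not_nonneg.{u} {A : Type u} [CStarAlgebra A] [PartialOrder A]
    [StarOrderedRing A] {a : A} (ha : IsSelfAdjoint a) (hneg : ¬ 0 ≤ a) :
    ∃ (H : Type u) (_ : NormedAddCommGroup H) (_ : InnerProductSpace ℂ H) (_ : CompleteSpace H)
      (π : A →⋆ₐ[ℂ] (H →L[ℂ] H)), IsIrreducibleRep π ∧ ¬ 0 ≤ π a := by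
  obtain ⟨φ, hφ, hφa⟩ := exists_extreme_state_apply_neg (a := (⟨a, ha⟩ : selfAdjoint A)) hneg
  set ρ := φ.toPositiveLinearMap hφ.1.1 with hρ
  let Ω : ρ.GNS := ((ρ.toPreGNS 1 : ρ.PreGNS) : ρ.GNS)
  have hΩ : ∀ b : A, ρ.gnsStarAlgHom b Ω = ((ρ.toPreGNS b : ρ.PreGNS) : ρ.GNS) := by
    intro b
    change ρ.gnsNonUnitalStarAlgHom b Ω = _
    rw [PositiveLinearMap.gnsNonUnitalStarAlgHom_apply_coe]
    simp
  have hinner : ∀ b : A, inner ℂ Ω (ρ.gnsStarAlgHom b Ω) = ρ b := by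
    intro b
    rw [hΩ, UniformSpace.Completion.inner_coe, PositiveLinearMap.preGNS_inner_def]
    simp
  have hvec : vectorFunctional ρ.gnsStarAlgHom Ω = φ := by
    refine DFunLike.ext _ _ fun b => ?_
    rw [vectorFunctional_apply, hinner, WeakDual.toPositiveLinearMap_apply, Complex.ofReal_re]
  have hΩ1 : ‖Ω‖ = 1 := by
    have h1 := inner_self_eq_norm_sq (𝕜 := ℂ) Ω
    have h2 := hinner 1
    have h3 := φ.toPositiveLinearMap_apply hφ.1.1 1
    rw [selfAdjoint.val_one, hφ.1.1.1] at h3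
    rw [map_one, one_apply_eq_self] at h2
    rw [h2.trans h3] at h1
    simp at h1
    exact (pow_eq_one_iff_of_nonneg (norm_nonneg Ω) two_ne_zero).1 h1.symm
  have hdense : DenseRange fun b : A => ρ.gnsStarAlgHom b Ω := by
    simp_rw [hΩ]
    exact UniformSpace.Completion.denseRange_coe.comp
      (ρ.toPreGNS.surjective.denseRange) (UniformSpace.Completion.continuous_coe _)
  refine ⟨ρ.GNS, inferInstance, inferInstance, inferInstance, ρ.gnsStarAlgHom,
    isIrreducibleRep_of_extreme hdense hΩ1 (a := (⟨a, ha⟩ : selfAdjoint A)) (hvec ▸ hφ),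
    fun h => ?_⟩
  rw [nonneg_iff_isPositive] at h
  have h1 := h.re_inner_nonneg_right Ω
  have h2 : vectorFunctional ρ.gnsStarAlgHom Ω ⟨a, ha⟩ < 0 := by rw [hvec]; exact hφa
  exact absurd h1 (not_le.2 h2)

end Representations

/-! ### The gap polynomial: monotonicity near `0` in dimension `N`. -/

section Gap

/-- The coefficients of `gapPoly`. Those of index less than `2 * N - 1` are the power sums of
`0, …, N - 1`, so that they form a positive definite Hankel matrix. -/
noncomputable def gapCoeff (N k : ℕ) : ℝ :=
  if k + 1 < 2 * N then ∑ i ∈ Finset.range N, (i : ℝ) ^ k else if k = 2 * N then -1 else 0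

/-- A polynomial which is matrix monotone of order `N` but not of order `N + 1` near `0`. -/
noncomputable def gapPoly (N : ℕ) : Polynomial ℝ :=
  ∑ k ∈ Finset.range (2 * N + 1), Polynomial.C (gapCoeff N k) * Polynomial.X ^ (k + 1)

theorem aeval_gapPoly {A : Type*} [Ring A] [Algebra ℝ A] (N : ℕ) (a : A) :
    Polynomial.aeval a (gapPoly N) =
      ∑ k ∈ Finset.range (2 * N + 1), gapCoeff N k • a ^ (k + 1) := by
  simp [gapPoly, Algebra.smul_def]

/-- The Vandermonde matrix at the distinct nodes `0, …, N - 1` is invertible, so the `z a` are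
bounded combinations of the vectors on the right. This makes the Hankel form positive definite. -/
theorem exists_sq_sum_norm_le (F : Type*) [NormedAddCommGroup F] [InnerProductSpace ℝ F] (N : ℕ) :
    ∃ D : ℝ, 0 < D ∧ ∀ z : ℕ → F, (∑ b ∈ Finset.range N, ‖z b‖) ^ 2 ≤
      D * ∑ i ∈ Finset.range N, ‖∑ a ∈ Finset.range N, (i : ℝ) ^ a • z a‖ ^ 2 := by
  set V : Matrix (Fin N) (Fin N) ℝ := Matrix.vandermonde fun i => ((i : ℕ) : ℝ) with hV
  have hdet : IsUnit V.det := by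
    rw [isUnit_iff_ne_zero, hV, Matrix.det_vandermonde_ne_zero_iff]
    intro i j hij
    exact Fin.ext (Nat.cast_injective hij)
  have hinv := Matrix.nonsing_inv_mul V hdet
  set B := V⁻¹
  set c : ℝ := ∑ a, ∑ i, |B a i| with hc
  have hc0 : 0 ≤ c := Finset.sum_nonneg fun _ _ => Finset.sum_nonneg fun _ _ => abs_nonneg _
  -- The summand `1` only ensures positivity, which would fail for `N = 0`.
  refine ⟨(N * c) ^ 2 * N + 1, by positivity, fun z => ?_⟩
  simp only [Finset.sum_range]
  set w : Fin N → F := fun i => ∑ a : Fin N, ((i : ℕ) : ℝ) ^ (a : ℕ) • z a with hw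
  have hz : ∀ a : Fin N, z a = ∑ i, B a i • w i := by
    intro a
    simp only [hw, Finset.smul_sum, smul_smul]
    rw [Finset.sum_comm]
    simp_rw [← Finset.sum_smul]
    have h1 : ∀ b : Fin N, ∑ i : Fin N, B a i * ((i : ℕ) : ℝ) ^ (b : ℕ) =
        if a = b then 1 else 0 := by
      intro b
      have := congrFun (congrFun hinv a) b
      rwa [Matrix.mul_apply, Matrix.one_apply] at this
    simp [h1]
  have hza : ∀ a : Fin N, ‖z a‖ ≤ c * ∑ i, ‖w i‖ := by
    intro a
    rw [hz a, Finset.mul_sum]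
    refine (norm_sum_le _ _).trans (Finset.sum_le_sum fun i _ => ?_)
    rw [norm_smul, Real.norm_eq_abs]
    gcongr
    exact (Finset.single_le_sum (f := fun j => |B a j|) (fun _ _ => abs_nonneg _)
      (Finset.mem_univ i)).trans (Finset.single_le_sum (f := fun b => ∑ j, |B b j|)
      (fun _ _ => Finset.sum_nonneg fun _ _ => abs_nonneg _) (Finset.mem_univ a))
  have hS : ∑ b : Fin N, ‖z b‖ ≤ N * c * ∑ i, ‖w i‖ := by
    refine (Finset.sum_le_sum fun a _ => hza a).trans ?_
    rw [Finset.sum_const, Finset.card_univ, Fintype.card_fin, nsmul_eq_mul, mul_assoc]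
  have hW : (∑ i, ‖w i‖) ^ 2 ≤ N * ∑ i, ‖w i‖ ^ 2 := by
    simpa using sq_sum_le_card_mul_sum_sq (s := Finset.univ) (f := fun i => ‖w i‖)
  have hW0 : 0 ≤ ∑ i, ‖w i‖ ^ 2 := Finset.sum_nonneg fun _ _ => sq_nonneg _
  calc (∑ b : Fin N, ‖z b‖) ^ 2 ≤ (N * c * ∑ i, ‖w i‖) ^ 2 := by
        refine pow_le_pow_left₀ (Finset.sum_nonneg fun _ _ => norm_nonneg _) hS 2
    _ = (N * c) ^ 2 * (∑ i, ‖w i‖) ^ 2 := mul_pow _ _ _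
    _ ≤ (N * c) ^ 2 * (N * ∑ i, ‖w i‖ ^ 2) := by gcongr
    _ ≤ _ := by rw [← mul_assoc, add_mul, one_mul]; linarith

/-- Coefficients of index above `2 * N` vanish, so the triangle `a + b ≤ 2 * N` may be completed to
a square. -/
theorem sum_gapCoeff_eq {N : ℕ} (f : ℕ → ℕ → ℝ) :
    ∑ k ∈ Finset.range (2 * N + 1), gapCoeff N k * ∑ a ∈ Finset.range (k + 1), f a (k - a) =
      ∑ a ∈ Finset.range (2 * N + 1), ∑ b ∈ Finset.range (2 * N + 1),
        gapCoeff N (a + b) * f a b := by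
  have h1 := Finset.sum_range_diag_flip (2 * N + 1) fun a b => gapCoeff N (a + b) * f a b
  calc _ = ∑ k ∈ Finset.range (2 * N + 1), ∑ a ∈ Finset.range (k + 1),
        gapCoeff N (a + (k - a)) * f a (k - a) := by
        refine Finset.sum_congr rfl fun k _ => ?_
        rw [Finset.mul_sum]
        refine Finset.sum_congr rfl fun a ha => ?_
        rw [Nat.add_sub_cancel' (Nat.lt_succ_iff.1 (Finset.mem_range.1 ha))]
    _ = _ := h1
    _ = _ := by
        refine Finset.sum_congr rfl fun a _ => ?_
        refine Finset.sum_subset (fun b hb => ?_) fun b hb hb' => ?_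
        · simp only [Finset.mem_range] at hb ⊢; omega
        · simp only [Finset.mem_range] at hb hb'
          have : gapCoeff N (a + b) = 0 := by
            rw [gapCoeff, if_neg (by omega), if_neg (by omega)]
          rw [this, zero_mul]

/-- The block `a, b < N` is a sum of squares `T` that dominates `S²`; every other term has a factor
of norm at most `γ S`, so for small `γ` the block wins. -/
theorem exists_gapCoeff_form_nonneg (F : Type*) [NormedAddCommGroup F] [InnerProductSpace ℝ F]
    (N : ℕ) : ∃ γ : ℝ, 0 < γ ∧ γ ≤ 1 ∧ ∀ z : ℕ → F,
      (∀ a, N ≤ a → ‖z a‖ ≤ γ * ∑ b ∈ Finset.range N, ‖z b‖) →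
      0 ≤ ∑ k ∈ Finset.range (2 * N + 1), gapCoeff N k *
        ∑ a ∈ Finset.range (k + 1), inner ℝ (z a) (z (k - a)) := by
  obtain ⟨D, hD, hDz⟩ := exists_sq_sum_norm_le F N
  set K := 2 * N + 1 with hK
  set M : ℝ := ∑ k ∈ Finset.range K, |gapCoeff N k| with hM
  have hM0 : 0 ≤ M := Finset.sum_nonneg fun _ _ => abs_nonneg _
  have hMk : ∀ k, |gapCoeff N k| ≤ M := by
    intro k
    by_cases hk : k < K
    · exact Finset.single_le_sum (f := fun k => |gapCoeff N k|) (fun _ _ => abs_nonneg _)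
        (Finset.mem_range.2 hk)
    · have : gapCoeff N k = 0 := by rw [gapCoeff, if_neg (by omega), if_neg (by omega)]
      rw [this, abs_zero]
      exact hM0
  -- There are `K ^ 2` terms, each with error at most `M γ S²`, and `S² ≤ D T`; the total error is
  -- at most `c γ T ≤ T`.
  set c : ℝ := K ^ 2 * M * D with hc
  have hc0 : 0 ≤ c := by positivity
  refine ⟨1 / (c + 1), by positivity, ?_, fun z hz => ?_⟩
  · rw [div_le_one (by positivity)]; linarith
  set γ := 1 / (c + 1) with hγ
  have hγ0 : 0 < γ := by positivity
  have hγ1 : γ ≤ 1 := by rw [hγ, div_le_one (by positivity)]; linarith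
  have hcγ : c * γ ≤ 1 := by rw [hγ, mul_one_div, div_le_one (by positivity)]; linarith
  rw [sum_gapCoeff_eq fun a b => inner ℝ (z a) (z b)]
  set S := ∑ b ∈ Finset.range N, ‖z b‖ with hS
  have hS0 : 0 ≤ S := Finset.sum_nonneg fun _ _ => norm_nonneg _
  have hzS : ∀ a, ‖z a‖ ≤ S := by
    intro a
    by_cases ha : a < N
    · exact Finset.single_le_sum (f := fun b => ‖z b‖) (fun _ _ => norm_nonneg _)
        (Finset.mem_range.2 ha)
    · exact (hz a (not_lt.1 ha)).trans (mul_le_of_le_one_left hS0 hγ1)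
  set T := ∑ i ∈ Finset.range N, ‖∑ a ∈ Finset.range N, (i : ℝ) ^ a • z a‖ ^ 2 with hT
  have hT0 : 0 ≤ T := Finset.sum_nonneg fun _ _ => sq_nonneg _
  let G : ℕ → ℕ → ℝ := fun a b =>
    if a < N ∧ b < N then gapCoeff N (a + b) * inner ℝ (z a) (z b) else 0
  have hG : ∑ a ∈ Finset.range K, ∑ b ∈ Finset.range K, G a b = T := by
    have hsub : Finset.range N ⊆ Finset.range K := by
      intro a ha
      rw [Finset.mem_range] at ha ⊢
      omega
    have h1 : ∑ a ∈ Finset.range K, ∑ b ∈ Finset.range K, G a b =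
        ∑ a ∈ Finset.range N, ∑ b ∈ Finset.range N, G a b := by
      rw [← Finset.sum_subset hsub]
      · refine Finset.sum_congr rfl fun a _ => ?_
        rw [← Finset.sum_subset hsub]
        intro b _ hb
        exact if_neg fun h => hb (Finset.mem_range.2 h.2)
      · intro a _ ha
        exact Finset.sum_eq_zero fun b _ => if_neg fun h => ha (Finset.mem_range.2 h.1)
    have h2 : ∀ a ∈ Finset.range N, ∀ b ∈ Finset.range N, G a b =
        ∑ i ∈ Finset.range N, inner ℝ ((i : ℝ) ^ a • z a) ((i : ℝ) ^ b • z b) := by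
      intro a ha b hb
      rw [Finset.mem_range] at ha hb
      simp only [G, if_pos (And.intro ha hb)]
      rw [gapCoeff, if_pos (by omega), Finset.sum_mul]
      refine Finset.sum_congr rfl fun i _ => ?_
      rw [real_inner_smul_left, real_inner_smul_right, pow_add, mul_assoc]
    rw [h1, Finset.sum_congr rfl fun a ha => Finset.sum_congr rfl (h2 a ha), hT]
    have h3 : ∀ i : ℕ, ‖∑ a ∈ Finset.range N, (i : ℝ) ^ a • z a‖ ^ 2 =
        ∑ a ∈ Finset.range N, ∑ b ∈ Finset.range N,
          inner ℝ ((i : ℝ) ^ a • z a) ((i : ℝ) ^ b • z b) := by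
      intro i
      rw [← real_inner_self_eq_norm_sq, sum_inner]
      simp_rw [inner_sum]
    simp_rw [h3]
    rw [Finset.sum_comm]
    conv_lhs => enter [2, b]; rw [Finset.sum_comm]
    rw [Finset.sum_comm]
    refine Finset.sum_congr rfl fun i _ => ?_
    rw [Finset.sum_comm]
  have hdiff : ∀ a b, G a b - M * γ * S ^ 2 ≤ gapCoeff N (a + b) * inner ℝ (z a) (z b) := by
    intro a b
    by_cases hab : a < N ∧ b < N
    · simp only [G, if_pos hab]
      have : 0 ≤ M * γ * S ^ 2 := by positivity
      linarith
    · simp only [G, if_neg hab]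
      have hprod : ‖z a‖ * ‖z b‖ ≤ γ * S ^ 2 := by
        rcases not_and_or.1 hab with h | h
        · calc _ ≤ (γ * S) * S := mul_le_mul (hz a (not_lt.1 h)) (hzS b) (norm_nonneg _)
                (by positivity)
            _ = _ := by ring
        · calc _ ≤ S * (γ * S) := mul_le_mul (hzS a) (hz b (not_lt.1 h)) (norm_nonneg _) hS0
            _ = _ := by ring
      have h1 : |gapCoeff N (a + b) * inner ℝ (z a) (z b)| ≤ M * (γ * S ^ 2) := by
        rw [abs_mul]
        exact mul_le_mul (hMk _) ((abs_real_inner_le_norm _ _).trans hprod) (abs_nonneg _) hM0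
      have := (abs_le.1 h1).1
      linarith
  have hsum : T - K ^ 2 * (M * γ * S ^ 2) ≤
      ∑ a ∈ Finset.range K, ∑ b ∈ Finset.range K, gapCoeff N (a + b) * inner ℝ (z a) (z b) := by
    calc _ = ∑ a ∈ Finset.range K, ∑ b ∈ Finset.range K, (G a b - M * γ * S ^ 2) := by
          simp only [Finset.sum_sub_distrib, hG, Finset.sum_const, Finset.card_range,
            nsmul_eq_mul]
          ring
      _ ≤ _ := Finset.sum_le_sum fun a _ => Finset.sum_le_sum fun b _ => hdiff a b
  refine le_trans ?_ hsum
  have h1 : K ^ 2 * (M * γ * S ^ 2) ≤ c * γ * T := by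
    calc _ = (K ^ 2 * M * γ) * S ^ 2 := by ring
      _ ≤ (K ^ 2 * M * γ) * (D * T) := by
        gcongr
        exact hDz z
      _ = _ := by rw [hc]; ring
  nlinarith

/-- By Cayley–Hamilton, `W ^ N` is a combination of lower powers. The eigenvalues have modulus at
most `α ≤ 1`, so the coefficients involved, elementary symmetric functions of them, are at most `α *
2 ^ N`. -/
theorem norm_pow_apply_le_of_finrank {E : Type*} [NormedAddCommGroup E] [InnerProductSpace ℂ E]
    [FiniteDimensional ℂ E] {W R : E →L[ℂ] E} {α γ : ℝ} (hα : ‖W‖ ≤ α) (hα1 : α ≤ 1)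
    (hγ1 : γ ≤ 1)
    (hαγ : Module.finrank ℂ E * (α * 2 ^ Module.finrank ℂ E) ≤ γ) (ξ : E) {a : ℕ}
    (ha : Module.finrank ℂ E ≤ a) :
    ‖R ((W ^ a) ξ)‖ ≤ γ * ∑ b ∈ Finset.range (Module.finrank ℂ E), ‖R ((W ^ b) ξ)‖ := by
  set N := Module.finrank ℂ E with hN
  have hα0 : 0 ≤ α := (norm_nonneg _).trans hα
  set p := (W : E →ₗ[ℂ] E).charpoly with hp
  have hmonic : p.Monic := LinearMap.charpoly_monic _
  have hdeg : p.natDegree = N := LinearMap.charpoly_natDegree _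
  have hroots : ∀ z ∈ (p.map (RingHom.id ℂ)).roots, ‖z‖ ≤ α := by
    intro z hz
    rw [Polynomial.map_id] at hz
    have h1 := Polynomial.isRoot_of_mem_roots hz
    rw [hp, ← Module.End.hasEigenvalue_iff_isRoot_charpoly] at h1
    obtain ⟨v, hv⟩ := h1.exists_hasEigenvector
    have h2 : W v = z • v := hv.apply_eq_smul
    have h3 : ‖z‖ * ‖v‖ ≤ α * ‖v‖ := by
      rw [← norm_smul, ← h2]
      exact (W.le_opNorm v).trans (by gcongr)
    exact le_of_mul_le_mul_right h3 (norm_pos_iff.2 hv.2)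
  have hcoeff : ∀ b < N, ‖p.coeff b‖ ≤ α * 2 ^ N := by
    intro b hb
    have h1 := Polynomial.coeff_le_of_roots_le (f := RingHom.id ℂ) b hmonic
      (IsAlgClosed.splits _) hroots
    rw [Polynomial.map_id, hdeg] at h1
    refine h1.trans ?_
    gcongr
    · calc α ^ (N - b) ≤ α ^ 1 := pow_le_pow_of_le_one hα0 hα1 (by omega)
        _ = α := pow_one α
    · exact_mod_cast Nat.choose_le_two_pow N b
  have hcayley : ∀ η : E, (W ^ N) η = -∑ b ∈ Finset.range N, p.coeff b • (W ^ b) η := by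
    intro η
    have h1 := LinearMap.aeval_self_charpoly (W : E →ₗ[ℂ] E)
    rw [← hp, Polynomial.aeval_eq_sum_range, hdeg, Finset.sum_range_succ,
      ← hdeg, hmonic.coeff_natDegree, hdeg, one_smul] at h1
    have h2 := congrArg (fun f : E →ₗ[ℂ] E => f η) h1
    have h3 : ∀ n, ((W : E →ₗ[ℂ] E) ^ n) η = (W ^ n) η := fun n => by
      rw [← ContinuousLinearMap.toLinearMap_pow]; rfl
    simp only [LinearMap.add_apply, LinearMap.sum_apply, LinearMap.smul_apply, h3,
      LinearMap.zero_apply] at h2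
    exact eq_neg_of_add_eq_zero_right h2
  set z : ℕ → E := fun a => R ((W ^ a) ξ) with hz
  set S := ∑ b ∈ Finset.range N, ‖z b‖ with hS
  have hS0 : 0 ≤ S := Finset.sum_nonneg fun _ _ => norm_nonneg _
  have hrec : ∀ m, z (N + m) = -∑ b ∈ Finset.range N, p.coeff b • z (b + m) := by
    intro m
    simp only [hz, pow_add, mul_apply_eq_comp]
    rw [hcayley, map_neg, map_sum]
    simp only [map_smul]
  have hstep : ∀ m, (∀ b < N, ‖z (b + m)‖ ≤ S) → ‖z (N + m)‖ ≤ γ * S := by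
    intro m hm
    rw [hrec, norm_neg]
    calc _ ≤ ∑ b ∈ Finset.range N, ‖p.coeff b • z (b + m)‖ := norm_sum_le _ _
      _ ≤ ∑ _b ∈ Finset.range N, (α * 2 ^ N) * S := by
        refine Finset.sum_le_sum fun b hb => ?_
        rw [Finset.mem_range] at hb
        rw [norm_smul]
        exact mul_le_mul (hcoeff b hb) (hm b hb) (norm_nonneg _) (by positivity)
      _ = (N * (α * 2 ^ N)) * S := by
        rw [Finset.sum_const, Finset.card_range, nsmul_eq_mul]; ring
      _ ≤ γ * S := by gcongr
  have hall : ∀ a, ‖z a‖ ≤ S := by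
    intro a
    induction a using Nat.strong_induction_on with
    | _ a ih =>
      by_cases h : a < N
      · exact Finset.single_le_sum (f := fun b => ‖z b‖) (fun _ _ => norm_nonneg _)
          (Finset.mem_range.2 h)
      · obtain ⟨m, rfl⟩ := Nat.exists_eq_add_of_le (not_lt.1 h)
        exact (hstep m fun b hb => ih _ (by omega)).trans (mul_le_of_le_one_left hS0 hγ1)
  obtain ⟨m, rfl⟩ := Nat.exists_eq_add_of_le ha
  exact hstep m fun b _ => hall _

/-- The hypothesis says that `ℓ` of the polynomial has nonnegative derivative along the segment from
`x` to `x + z`. -/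
theorem apply_aeval_gapPoly_le {A : Type*} [CStarAlgebra A] {N : ℕ} {x z : A} (ℓ : A →L[ℝ] ℝ)
    (h : ∀ t ∈ Set.Icc (0 : ℝ) 1, 0 ≤ ∑ k ∈ Finset.range (2 * N + 1), gapCoeff N k *
      ∑ a ∈ Finset.range (k + 1), ℓ ((x + t • z) ^ (k - a) * z * (x + t • z) ^ a)) :
    ℓ (Polynomial.aeval x (gapPoly N)) ≤ ℓ (Polynomial.aeval (x + z) (gapPoly N)) := by
  have hd : ∀ t : ℝ, HasDerivAt (fun t : ℝ => ℓ (Polynomial.aeval (x + t • z) (gapPoly N)))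
      (∑ k ∈ Finset.range (2 * N + 1), gapCoeff N k *
      ∑ a ∈ Finset.range (k + 1), ℓ ((x + t • z) ^ (k - a) * z * (x + t • z) ^ a)) t := by
    intro t
    have h1 : HasDerivAt (fun t : ℝ => x + t • z) z t := by
      simpa using ((hasDerivAt_id t).smul_const z).const_add x
    have h2 : HasDerivAt (fun t : ℝ => ∑ k ∈ Finset.range (2 * N + 1),
        gapCoeff N k • (x + t • z) ^ (k + 1)) (∑ k ∈ Finset.range (2 * N + 1), gapCoeff N k •
        ∑ a ∈ Finset.range (k + 1), ((x + t • z) ^ (k - a) * z * (x + t • z) ^ a)) t :=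
      HasDerivAt.fun_sum fun k _ => (h1.fun_pow' (k + 1)).const_smul (gapCoeff N k)
    have h3 := ℓ.hasFDerivAt.comp_hasDerivAt t h2
    simp only [map_sum, map_smul, smul_eq_mul] at h3
    simp only [aeval_gapPoly, map_sum, map_smul, smul_eq_mul]
    simpa [Function.comp_def] using! h3
  have hmono := monotoneOn_of_hasDerivWithinAt_nonneg (convex_Icc (0 : ℝ) 1)
    (fun t _ => (hd t).continuousAt.continuousWithinAt)
    (fun t _ => (hd t).hasDerivWithinAt)
    (fun t ht => h t (interior_subset ht))
  have := hmono (Set.left_mem_Icc.2 zero_le_one) (Set.right_mem_Icc.2 zero_le_one) zero_le_one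
  simpa using this

/-- The functional `T ↦ re ⟪ξ, T ξ⟫`. -/
noncomputable def reQuadratic {E : Type*} [NormedAddCommGroup E] [InnerProductSpace ℂ E] (ξ : E) :
    (E →L[ℂ] E) →L[ℝ] ℝ :=
  Complex.reCLM ∘L ((innerSL ℂ ξ) ∘L (ContinuousLinearMap.apply ℂ E ξ)).restrictScalars ℝ

theorem reQuadratic_apply {E : Type*} [NormedAddCommGroup E] [InnerProductSpace ℂ E] (ξ : E)
    (T : E →L[ℂ] E) : reQuadratic ξ T = (inner ℂ ξ (T ξ)).re := rfl

theorem isSelfAdjoint_aeval {A : Type*} [CStarAlgebra A] {a : A} (ha : IsSelfAdjoint a)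
    (q : Polynomial ℝ) : IsSelfAdjoint (Polynomial.aeval a q) := by
  rw [← cfc_polynomial q a]
  exact cfc_predicate _ _

theorem le_iff_reQuadratic_le {E : Type*} [NormedAddCommGroup E] [InnerProductSpace ℂ E]
    [CompleteSpace E] {S T : E →L[ℂ] E} (hS : IsSelfAdjoint S) (hT : IsSelfAdjoint T) :
    S ≤ T ↔ ∀ ξ, reQuadratic ξ S ≤ reQuadratic ξ T := by
  rw [ContinuousLinearMap.le_def, isPositive_def']
  refine ⟨fun h ξ => ?_, fun h => ⟨hT.sub hS, fun ξ => ?_⟩⟩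
  · have h1 := h.2 ξ
    rw [reApplyInnerSelf, inner_re_symm] at h1
    rw [← sub_nonneg, ← map_sub]
    exact h1
  · rw [reApplyInnerSelf, inner_re_symm]
    have h1 := sub_nonneg.2 (h ξ)
    rw [← map_sub] at h1
    exact h1

theorem norm_add_smul_sub_le {A : Type*} [CStarAlgebra A] [PartialOrder A] [StarOrderedRing A]
    {x z : A} (hx : 0 ≤ x) (hz : 0 ≤ z) {t : ℝ} (ht : t ∈ Set.Icc (0 : ℝ) 1) :
    IsSelfAdjoint (x + t • z) ∧ ‖x + t • z‖ ≤ ‖x + z‖ := by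
  have h1 : 0 ≤ t • z := smul_nonneg ht.1 hz
  have h2 : 0 ≤ (1 - t) • z := smul_nonneg (sub_nonneg.2 ht.2) hz
  have h3 : 0 ≤ x + t • z := add_nonneg hx h1
  refine ⟨h3.isSelfAdjoint, CStarAlgebra.norm_le_norm_of_nonneg_of_le h3 ?_⟩
  rw [sub_smul, one_smul, sub_nonneg] at h2
  exact add_le_add_right h2 x

/-- Near `0`, the polynomial `gapPoly N` is monotone on the self-adjoint operators of an
`N`-dimensional space. -/
theorem exists_aeval_gapPoly_le (E : Type*) [NormedAddCommGroup E] [InnerProductSpace ℂ E]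
    [FiniteDimensional ℂ E] :
    ∃ α : ℝ, 0 < α ∧ ∀ x y : E →L[ℂ] E, 0 ≤ x → x ≤ y → ‖y‖ ≤ α →
      Polynomial.aeval x (gapPoly (Module.finrank ℂ E)) ≤
        Polynomial.aeval y (gapPoly (Module.finrank ℂ E)) := by
  have : CompleteSpace E := FiniteDimensional.complete ℂ E
  set N := Module.finrank ℂ E with hN
  let : InnerProductSpace ℝ E := InnerProductSpace.complexToReal
  obtain ⟨γ, hγ0, hγ1, hγ⟩ := exists_gapCoeff_form_nonneg E N
  -- With `α = γ / c`, both `α ≤ 1` and `N * (α * 2 ^ N) ≤ γ` hold.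
  set c : ℝ := N * 2 ^ N + 1 with hc
  have hc1 : 1 ≤ c := by rw [hc]; have : (0 : ℝ) ≤ N * 2 ^ N := by positivity
                         linarith
  refine ⟨γ / c, by positivity, fun x y hx hxy hy => ?_⟩
  have hα1 : γ / c ≤ 1 := (div_le_one (by positivity)).2 (hγ1.trans hc1)
  have hαγ : N * (γ / c * 2 ^ N) ≤ γ := by
    have : N * (γ / c * 2 ^ N) = γ * (N * 2 ^ N / c) := by field_simp
    rw [this]
    refine mul_le_of_le_one_right hγ0.le ((div_le_one (by positivity)).2 ?_)
    rw [hc]; linarith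
  have hz : 0 ≤ y - x := sub_nonneg.2 hxy
  have hy0 : IsSelfAdjoint y := (hx.trans hxy).isSelfAdjoint
  rw [le_iff_reQuadratic_le (isSelfAdjoint_aeval hx.isSelfAdjoint _) (isSelfAdjoint_aeval hy0 _)]
  intro ξ
  have hxz : x + (y - x) = y := by abel
  conv_rhs => rw [← hxz]
  refine apply_aeval_gapPoly_le (reQuadratic ξ) fun t ht => ?_
  obtain ⟨hWs, hWn⟩ := norm_add_smul_sub_le hx hz ht
  rw [hxz] at hWn
  set W := x + t • (y - x) with hW
  set R := CFC.sqrt (y - x) with hR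
  have hRR : R * R = y - x := CFC.sqrt_mul_sqrt_self (y - x)
  have hRs : IsSelfAdjoint R := (CFC.sqrt_nonneg _).isSelfAdjoint
  -- With `y - x = R²`, the derivative at `ξ` is the Hankel form evaluated at the vectors `R W^a ξ`.
  have key := hγ (fun a => R ((W ^ a) ξ)) fun a ha =>
    norm_pow_apply_le_of_finrank (hWn.trans hy) hα1 hγ1 hαγ ξ ha
  convert! key using 4 with k _ a ha
  rw [reQuadratic_apply, ← hRR]
  change (inner ℂ ξ ((W ^ (k - a) * (R * R) * W ^ a) ξ)).re =
    (inner ℂ (R ((W ^ a) ξ)) (R ((W ^ (k - a)) ξ))).re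
  have h1 : inner ℂ ξ ((W ^ (k - a) * (R * R) * W ^ a) ξ) =
      inner ℂ (R ((W ^ (k - a)) ξ)) (R ((W ^ a) ξ)) := by
    simp only [mul_apply_eq_comp]
    conv_lhs => rw [← (hWs.pow (k - a)).star_eq, star_eq_adjoint, adjoint_inner_right]
    conv_rhs => rw [← adjoint_inner_right, ← star_eq_adjoint, hRs.star_eq]
  rw [h1]
  exact inner_re_symm (𝕜 := ℂ) _ _

end Gap

/-! ### Failure of monotonicity in dimension `N + 1`. -/

section NotMonotone

/-- Adding `p` leaves `x ^ j e` unchanged for `j ≤ N`, hence also the moments up to order `2 * N`.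
The moment of order `2 * N + 1` increases, and its coefficient is `-1`. -/
theorem reQuadratic_aeval_gapPoly_lt {H : Type*} [NormedAddCommGroup H] [InnerProductSpace ℂ H]
    [CompleteSpace H] {N : ℕ} {x p : H →L[ℂ] H} (hx : IsSelfAdjoint x) (hp : IsSelfAdjoint p)
    {e : H} (h0 : ∀ i < N, p ((x ^ i) e) = 0)
    (hN : 0 < (inner ℂ ((x ^ N) e) (p ((x ^ N) e))).re) :
    reQuadratic e (Polynomial.aeval (x + p) (gapPoly N)) <
      reQuadratic e (Polynomial.aeval x (gapPoly N)) := by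
  have hpow : ∀ j ≤ N, ((x + p) ^ j) e = (x ^ j) e := by
    intro j
    induction j with
    | zero => simp
    | succ j ih =>
      intro hj
      rw [pow_succ', mul_apply_eq_comp, ih (by omega), add_apply, h0 j (by omega), add_zero,
        pow_succ', mul_apply_eq_comp]
  have hsplit : ∀ (w : H →L[ℂ] H), IsSelfAdjoint w → ∀ i j,
      inner ℂ e ((w ^ (i + j)) e) = inner ℂ ((w ^ i) e) ((w ^ j) e) := by
    intro w hw i j
    rw [pow_add, mul_apply_eq_comp]
    conv_lhs => rw [← (hw.pow i).star_eq, star_eq_adjoint, adjoint_inner_right]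
  have hlow : ∀ k ≤ 2 * N, inner ℂ e (((x + p) ^ k) e) = inner ℂ e ((x ^ k) e) := by
    intro k hk
    obtain ⟨i, j, hi, hj, rfl⟩ : ∃ i j, i ≤ N ∧ j ≤ N ∧ k = i + j :=
      ⟨min k N, k - min k N, by omega, by omega, by omega⟩
    rw [hsplit _ (hx.add hp), hsplit _ hx, hpow i hi, hpow j hj]
  have htop : inner ℂ e (((x + p) ^ (2 * N + 1)) e) =
      inner ℂ e ((x ^ (2 * N + 1)) e) + inner ℂ ((x ^ N) e) (p ((x ^ N) e)) := by
    have h2 : 2 * N + 1 = N + (1 + N) := by omega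
    rw [h2, hsplit _ (hx.add hp), hsplit _ hx, pow_add (x + p), pow_add x, mul_apply_eq_comp,
      mul_apply_eq_comp, hpow N le_rfl, pow_one, pow_one, add_apply, inner_add_right]
  simp only [aeval_gapPoly, map_sum, map_smul, smul_eq_mul, reQuadratic_apply]
  rw [Finset.sum_range_succ, Finset.sum_range_succ, htop, Complex.add_re]
  have h3 : gapCoeff N (2 * N) = -1 := by rw [gapCoeff, if_neg (by omega), if_pos rfl]
  have h4 : ∑ k ∈ Finset.range (2 * N), gapCoeff N k * (inner ℂ e (((x + p) ^ (k + 1)) e)).re =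
      ∑ k ∈ Finset.range (2 * N), gapCoeff N k * (inner ℂ e ((x ^ (k + 1)) e)).re :=
    Finset.sum_congr rfl fun k hk => by
      rw [hlow (k + 1) (by rw [Finset.mem_range] at hk; omega)]
  rw [h3, h4]
  linarith

/-- A positive operator on an `N + 1`-dimensional space with two vectors whose moments of order
less than `N` vanish. -/
theorem exists_nonneg_moments (N : ℕ) :
    ∃ (g : EuclideanSpace ℂ (Fin (N + 1)) →L[ℂ] EuclideanSpace ℂ (Fin (N + 1)))
      (e f : EuclideanSpace ℂ (Fin (N + 1))), 0 ≤ g ∧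
      (∀ i < N, inner ℂ f ((g ^ i) e) = 0) ∧ inner ℂ f ((g ^ N) e) = 1 := by
  -- The eigenvalues are squares so that `g = D * D` is visibly positive. With `f` constant `1` and
  -- `e` the last row of the inverse Vandermonde matrix, the moments are the last row of the
  -- identity.
  set v : Fin (N + 1) → ℂ := fun i => ((i : ℕ) : ℂ) ^ 2 with hv
  set V := Matrix.vandermonde v with hV
  have hdet : IsUnit V.det := by
    rw [isUnit_iff_ne_zero, hV, Matrix.det_vandermonde_ne_zero_iff]
    intro i j hij
    have h1 : ((i : ℕ) : ℝ) ^ 2 = ((j : ℕ) : ℝ) ^ 2 := by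
      have : (((i : ℕ) : ℝ) : ℂ) ^ 2 = (((j : ℕ) : ℝ) : ℂ) ^ 2 := by simpa [hv] using hij
      exact_mod_cast this
    have h2 := (pow_left_inj₀ (Nat.cast_nonneg _) (Nat.cast_nonneg _) two_ne_zero).1 h1
    exact Fin.ext (Nat.cast_injective h2)
  have hinv := Matrix.nonsing_inv_mul V hdet
  set D := Matrix.toEuclideanCLM (n := Fin (N + 1)) (𝕜 := ℂ)
    (Matrix.diagonal fun i => ((i : ℕ) : ℂ)) with hD
  have hDs : IsSelfAdjoint D := by
    refine IsSelfAdjoint.map ?_ _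
    rw [isSelfAdjoint_iff, Matrix.star_eq_conjTranspose, Matrix.diagonal_conjTranspose]
    congr 1
    ext i
    simp
  have hpow : ∀ k, (D * D) ^ k = Matrix.toEuclideanCLM (n := Fin (N + 1)) (𝕜 := ℂ)
      (Matrix.diagonal fun i => v i ^ k) := by
    intro k
    rw [hD, ← map_mul, ← map_pow, Matrix.diagonal_mul_diagonal, Matrix.diagonal_pow]
    congr 2
    ext i
    simp [hv, sq]
  have hmom : ∀ k : Fin (N + 1), inner ℂ (WithLp.toLp 2 fun _ : Fin (N + 1) => (1 : ℂ))
      (((D * D) ^ (k : ℕ)) (WithLp.toLp 2 fun i => V⁻¹ (Fin.last N) i)) =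
      if Fin.last N = k then 1 else 0 := by
    intro k
    have h1 := congrFun (congrFun hinv (Fin.last N)) k
    rw [Matrix.mul_apply, Matrix.one_apply] at h1
    rw [← h1, hpow, Matrix.toEuclideanCLM_toLp, PiLp.inner_apply]
    refine Finset.sum_congr rfl fun i _ => ?_
    rw [hV, Matrix.vandermonde_apply]
    simp [Matrix.mulVec_diagonal, mul_comm]
  refine ⟨D * D, WithLp.toLp 2 fun i => V⁻¹ (Fin.last N) i, WithLp.toLp 2 fun _ => 1,
    hDs.mul_self_nonneg, fun i hi => ?_, ?_⟩
  · have := hmom ⟨i, by omega⟩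
    rwa [if_neg] at this
    intro h
    have := congrArg Fin.val h
    simp only [Fin.val_last] at this
    omega
  · simpa using! hmom (Fin.last N)

theorem ofReal_smul_nonneg {A : Type*} [CStarAlgebra A] [PartialOrder A] [StarOrderedRing A]
    {a : A} (ha : 0 ≤ a) {r : ℝ} (hr : 0 ≤ r) : 0 ≤ (r : ℂ) • a := by
  rw [Complex.coe_smul]
  exact smul_nonneg hr ha

theorem exists_not_aeval_gapPoly_le (N : ℕ) {β : ℝ} (hβ : 0 < β) :
    ∃ x y : EuclideanSpace ℂ (Fin (N + 1)) →L[ℂ] EuclideanSpace ℂ (Fin (N + 1)),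
      0 ≤ x ∧ x ≤ y ∧ ‖y‖ < β ∧
      ¬ Polynomial.aeval x (gapPoly N) ≤ Polynomial.aeval y (gapPoly N) := by
  obtain ⟨g, e, f, hg, hlow, htop⟩ := exists_nonneg_moments N
  set p := InnerProductSpace.rankOne ℂ f f with hp
  have hpapp : ∀ z, p z = inner ℂ f z • f := fun z => rfl
  have hp0 : 0 ≤ p := by
    rw [nonneg_iff_isPositive, isPositive_iff_complex]
    intro z
    rw [hpapp, inner_smul_left, mul_comm, Complex.mul_conj]
    exact ⟨rfl, Complex.normSq_nonneg _⟩
  -- Scaling brings the norm below `β` and multiplies the moments by powers of `ε`, so the vanishing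
  -- pattern survives.
  set ε : ℝ := β / (‖g‖ + ‖p‖ + 1) with hε
  have hε0 : 0 < ε := by positivity
  have hxs : 0 ≤ (ε : ℂ) • g := ofReal_smul_nonneg hg hε0.le
  have hps : 0 ≤ (ε : ℂ) • p := ofReal_smul_nonneg hp0 hε0.le
  have hpw : ∀ i, (((ε : ℂ) • g) ^ i) e = (ε : ℂ) ^ i • (g ^ i) e := fun i => by
    rw [smul_pow, smul_apply]
  refine ⟨(ε : ℂ) • g, (ε : ℂ) • g + (ε : ℂ) • p, hxs, le_add_of_nonneg_right hps, ?_, ?_⟩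
  · calc ‖(ε : ℂ) • g + (ε : ℂ) • p‖ ≤ ‖(ε : ℂ) • g‖ + ‖(ε : ℂ) • p‖ := norm_add_le _ _
      _ = ε * (‖g‖ + ‖p‖) := by
        rw [norm_smul, norm_smul, Complex.norm_of_nonneg hε0.le, mul_add]
      _ < ε * (‖g‖ + ‖p‖ + 1) := mul_lt_mul_of_pos_left (lt_add_one _) hε0
      _ = β := by rw [hε]; field_simp
  · intro hle
    rw [le_iff_reQuadratic_le (isSelfAdjoint_aeval hxs.isSelfAdjoint _)
      (isSelfAdjoint_aeval (add_nonneg hxs hps).isSelfAdjoint _)] at hle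
    refine absurd (hle e) (not_le.2 (reQuadratic_aeval_gapPoly_lt hxs.isSelfAdjoint
      hps.isSelfAdjoint (fun i hi => ?_) ?_))
    · rw [hpw, map_smul, smul_apply, hpapp, hlow i hi]
      simp
    · rw [hpw, map_smul, smul_apply, hpapp, htop, one_smul, inner_smul_left, inner_smul_right,
        inner_smul_right, ← inner_conj_symm, htop]
      simp only [map_pow, Complex.conj_ofReal, map_one, mul_one]
      have : (0 : ℝ) < ε ^ N * (ε ^ N * ε) := by positivity
      exact_mod_cast this

end NotMonotone

/-! ### Operator monotone Möbius maps between `[0, ∞)` and `[0, α)`. -/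

section Moebius

open Ring

variable {A : Type*} [CStarAlgebra A] [PartialOrder A] [StarOrderedRing A]

/-- Isolating the inverse reduces monotonicity to the antitonicity of inversion on strictly positive
elements. -/
theorem cfc_moebius_eq {α : ℝ} {x : A} (hx : 0 ≤ x) :
    cfc (fun s : ℝ => α * s / (1 + s)) x = algebraMap ℝ A α - α • (1 + x)⁻¹ʳ := by
  have hsp : ∀ t ∈ spectrum ℝ x, 1 + t ≠ 0 := fun t ht => by
    have := spectrum_nonneg_of_nonneg hx ht
    positivity
  have hc : ContinuousOn (fun s : ℝ => (1 + s)⁻¹) (spectrum ℝ x) :=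
    ContinuousOn.inv₀ (by fun_prop) hsp
  have h1 : cfc (fun s : ℝ => 1 + s) x = 1 + x := by
    rw [cfc_add (hf := by fun_prop) (hg := by fun_prop), cfc_const_one ℝ x, cfc_id' ℝ x]
  rw [← h1, ← cfc_inv (fun s : ℝ => 1 + s) x hsp (by fun_prop), ← cfc_const α x,
    ← cfc_smul α _ x hc, ← cfc_sub (hf := by fun_prop) (hg := by fun_prop)]
  refine cfc_congr fun t ht => ?_
  have := hsp t ht
  simp only [smul_eq_mul]
  field_simp
  ring

theorem cfc_moebius_mono {α : ℝ} (hα : 0 ≤ α) {x y : A} (hx : 0 ≤ x) (hxy : x ≤ y) :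
    cfc (fun s : ℝ => α * s / (1 + s)) x ≤ cfc (fun s : ℝ => α * s / (1 + s)) y := by
  rw [cfc_moebius_eq hx, cfc_moebius_eq (hx.trans hxy)]
  have h1 : IsStrictlyPositive (1 + x) := isStrictlyPositive_one.add_nonneg hx
  have h2 : (1 + y)⁻¹ʳ ≤ (1 + x)⁻¹ʳ :=
    CStarAlgebra.ringInverse_le_ringInverse (add_le_add_right hxy 1) h1
  exact sub_le_sub_left (smul_le_smul_of_nonneg_left h2 hα) _

theorem spectrum_subset_Ico {α : ℝ} {x : A} (hx : 0 ≤ x) (hα : ‖x‖ < α) :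
    spectrum ℝ x ⊆ Set.Ico 0 α := fun _ ht =>
  ⟨spectrum_nonneg_of_nonneg hx ht,
    (le_abs_self _).trans_lt ((abs_le_norm_of_mem_spectrum ht).trans_lt hα)⟩

theorem cfc_moebius_symm_eq {α : ℝ} {x : A} (hx : 0 ≤ x) (hα : ‖x‖ < α) :
    cfc (fun t : ℝ => t / (α - t)) x = α • (algebraMap ℝ A α - x)⁻¹ʳ - 1 := by
  have hsp : ∀ t ∈ spectrum ℝ x, α - t ≠ 0 := fun t ht =>
    (sub_pos.2 (spectrum_subset_Ico hx hα ht).2).ne'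
  have hc : ContinuousOn (fun s : ℝ => (α - s)⁻¹) (spectrum ℝ x) :=
    ContinuousOn.inv₀ (by fun_prop) hsp
  have h1 : cfc (fun s : ℝ => α - s) x = algebraMap ℝ A α - x := by
    rw [cfc_sub (hf := by fun_prop) (hg := by fun_prop), cfc_const α x, cfc_id' ℝ x]
  rw [← h1, ← cfc_inv (fun s : ℝ => α - s) x hsp (by fun_prop), ← cfc_const_one ℝ x,
    ← cfc_smul α _ x hc, ← cfc_sub (hf := by fun_prop) (hg := by fun_prop)]
  refine cfc_congr fun t ht => ?_
  have := hsp t ht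
  simp only [smul_eq_mul]
  field_simp
  ring

theorem cfc_moebius_symm_mono {α : ℝ} {x y : A} (hx : 0 ≤ x) (hxy : x ≤ y) (hy : ‖y‖ < α) :
    cfc (fun t : ℝ => t / (α - t)) x ≤ cfc (fun t : ℝ => t / (α - t)) y := by
  have hα : 0 < α := (norm_nonneg y).trans_lt hy
  have hy0 := hx.trans hxy
  have hxn : ‖x‖ < α := (CStarAlgebra.norm_le_norm_of_nonneg_of_le hx hxy).trans_lt hy
  rw [cfc_moebius_symm_eq hx hxn, cfc_moebius_symm_eq hy0 hy]
  have h1 : IsStrictlyPositive (algebraMap ℝ A α - y) := by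
    have hsa : IsSelfAdjoint (algebraMap ℝ A α - y) :=
      (IsSelfAdjoint.algebraMap A (IsSelfAdjoint.all α)).sub hy0.isSelfAdjoint
    rw [StarOrderedRing.isStrictlyPositive_iff_spectrum_pos (R := ℝ) _ hsa]
    intro t ht
    have h2 : cfc (fun s : ℝ => α - s) y = algebraMap ℝ A α - y := by
      rw [cfc_sub (hf := by fun_prop) (hg := by fun_prop), cfc_const α y, cfc_id' ℝ y]
    rw [← h2, cfc_map_spectrum (fun s : ℝ => α - s) y] at ht
    obtain ⟨s, hs, rfl⟩ := ht
    exact sub_pos.2 (spectrum_subset_Ico hy0 hy hs).2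
  have h2 : (algebraMap ℝ A α - x)⁻¹ʳ ≤ (algebraMap ℝ A α - y)⁻¹ʳ :=
    CStarAlgebra.ringInverse_le_ringInverse (sub_le_sub_left hxy _) h1
  exact sub_le_sub_right (smul_le_smul_of_nonneg_left h2 hα.le) _

theorem continuousOn_eval_moebius (q : Polynomial ℝ) (α : ℝ) :
    ContinuousOn (fun s : ℝ => q.eval (α * s / (1 + s))) (Set.Ici 0) :=
  q.continuous.comp_continuousOn <| ContinuousOn.div (by fun_prop) (by fun_prop) fun s hs => by
    have : (0 : ℝ) ≤ s := hs
    positivity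

theorem cfc_eval_moebius (q : Polynomial ℝ) {α : ℝ} {x : A} (hx : 0 ≤ x) :
    cfc (fun s : ℝ => q.eval (α * s / (1 + s))) x =
      Polynomial.aeval (cfc (fun s : ℝ => α * s / (1 + s)) x) q := by
  rw [← cfc_polynomial q _ (cfc_predicate _ _)]
  refine cfc_comp' _ _ x q.continuous.continuousOn ?_
  exact ContinuousOn.div (by fun_prop) (by fun_prop) fun t ht => by
    have := spectrum_nonneg_of_nonneg hx ht
    positivity

theorem cfc_eval_moebius_symm (q : Polynomial ℝ) {α : ℝ} {x : A} (hx : 0 ≤ x) (hα : ‖x‖ < α) :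
    cfc (fun s : ℝ => q.eval (α * s / (1 + s))) (cfc (fun t : ℝ => t / (α - t)) x) =
      Polynomial.aeval x q := by
  have hsp := spectrum_subset_Ico hx hα
  have hcf : ContinuousOn (fun t : ℝ => t / (α - t)) (spectrum ℝ x) :=
    ContinuousOn.div (by fun_prop) (by fun_prop) fun t ht => (sub_pos.2 (hsp ht).2).ne'
  have hcg : ContinuousOn (fun s : ℝ => q.eval (α * s / (1 + s)))
      ((fun t : ℝ => t / (α - t)) '' spectrum ℝ x) := by
    refine (continuousOn_eval_moebius q α).mono ?_
    rintro _ ⟨t, ht, rfl⟩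
    exact div_nonneg (hsp ht).1 (sub_pos.2 (hsp ht).2).le
  rw [← cfc_comp' _ _ x hcg hcf, ← cfc_polynomial q x]
  refine cfc_congr fun t ht => ?_
  have h1 : 0 < α - t := sub_pos.2 (hsp ht).2
  have h2 : α ≠ 0 := by linarith [(hsp ht).1]
  have h3 : α * (t / (α - t)) / (1 + t / (α - t)) = t := by
    have : 1 + t / (α - t) = α / (α - t) := by field_simp; ring
    rw [this]
    field_simp
  simp only [h3]

end Moebius

/-- The gap theorem: some function on `[0, ∞)` is matrix monotone of order `N` but not of order
`N + 1`. -/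
theorem exists_monotoneClass_gap (N : ℕ) :
    ∃ f ∈ monotoneClass (EuclideanSpace ℂ (Fin N) →L[ℂ] EuclideanSpace ℂ (Fin N)) (Set.Ici 0),
      f ∉ monotoneClass (EuclideanSpace ℂ (Fin (N + 1)) →L[ℂ] EuclideanSpace ℂ (Fin (N + 1)))
        (Set.Ici 0) := by
  obtain ⟨α, hα, hmono⟩ := exists_aeval_gapPoly_le (EuclideanSpace ℂ (Fin N))
  rw [finrank_euclideanSpace_fin] at hmono
  refine ⟨fun s => (gapPoly N).eval (α * s / (1 + s)), ⟨continuousOn_eval_moebius _ _,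
    fun x y hx hy hxσ hyσ hxy => ?_⟩, fun hf => ?_⟩
  · have hx0 : 0 ≤ x := (StarOrderedRing.nonneg_iff_spectrum_nonneg (R := ℝ) x hx).2 hxσ
    have hy0 := hx0.trans hxy
    rw [cfc_eval_moebius _ hx0, cfc_eval_moebius _ hy0]
    refine hmono _ _ (cfc_nonneg fun t ht => ?_) (cfc_moebius_mono hα.le hx0 hxy)
      (norm_cfc_le hα.le fun t ht => ?_)
    · have := hxσ ht
      rw [Set.mem_Ici] at this
      positivity
    · have : 0 ≤ t := hyσ ht
      rw [Real.norm_of_nonneg (by positivity), div_le_iff₀ (by positivity)]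
      nlinarith
  · obtain ⟨x, y, hx, hxy, hy, hnot⟩ := exists_not_aeval_gapPoly_le N hα
    -- The inverse Möbius map `t / (α - t)` is also operator monotone, so it carries the
    -- counterexample near `0` to one on `[0, ∞)`.
    have hy0 := hx.trans hxy
    have hxn : ‖x‖ < α := (CStarAlgebra.norm_le_norm_of_nonneg_of_le hx hxy).trans_lt hy
    have hnn : ∀ z : EuclideanSpace ℂ (Fin (N + 1)) →L[ℂ] EuclideanSpace ℂ (Fin (N + 1)), 0 ≤ z →
        ‖z‖ < α → 0 ≤ cfc (fun t : ℝ => t / (α - t)) z := fun z hz hzn => cfc_nonneg fun t ht =>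
      div_nonneg (spectrum_subset_Ico hz hzn ht).1 (sub_pos.2 (spectrum_subset_Ico hz hzn ht).2).le
    have h1 := hf.2 _ _ (hnn x hx hxn).isSelfAdjoint (hnn y hy0 hy).isSelfAdjoint
      (fun t ht => spectrum_nonneg_of_nonneg (hnn x hx hxn) ht)
      (fun t ht => spectrum_nonneg_of_nonneg (hnn y hy0 hy) ht) (cfc_moebius_symm_mono hx hxy hy)
    rw [cfc_eval_moebius_symm _ hx hxn, cfc_eval_moebius_symm _ hy0 hy] at h1
    exact hnot h1

/-! ### Comparison of the monotone classes of `A`, `B(H)` and matrix algebras. -/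

section Comparison

theorem monotoneClass_subset_of_starAlgEquiv {A B : Type*} [CStarAlgebra A] [PartialOrder A]
    [StarOrderedRing A] [CStarAlgebra B] [PartialOrder B] [StarOrderedRing B] (e : A ≃⋆ₐ[ℂ] B) :
    monotoneClass A (Set.Ici 0) ⊆ monotoneClass B (Set.Ici 0) := by
  rintro f ⟨hfc, hf⟩
  refine ⟨hfc, fun x y hx hy hxσ hyσ hxy => ?_⟩
  let π : A →⋆ₐ[ℂ] B := (e : A →⋆ₐ[ℂ] B)
  let ρ : B →⋆ₐ[ℂ] A := (e.symm : B →⋆ₐ[ℂ] A)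
  have hπρ : ∀ b, π (ρ b) = b := e.apply_symm_apply
  have hx0 : 0 ≤ x := (StarOrderedRing.nonneg_iff_spectrum_nonneg (R := ℝ) x hx).2 hxσ
  have hy0 : 0 ≤ y := hx0.trans hxy
  have hρx : 0 ≤ ρ x := map_nonneg ρ hx0
  have hρy : 0 ≤ ρ y := map_nonneg ρ hy0
  have hsx : spectrum ℝ (ρ x) ⊆ Set.Ici 0 := fun t ht => spectrum_nonneg_of_nonneg hρx ht
  have hsy : spectrum ℝ (ρ y) ⊆ Set.Ici 0 := fun t ht => spectrum_nonneg_of_nonneg hρy ht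
  have h := OrderHomClass.mono π (hf _ _ hρx.isSelfAdjoint hρy.isSelfAdjoint hsx hsy
    (OrderHomClass.mono ρ hxy))
  rwa [StarAlgHom.map_cfc_real π hρx.isSelfAdjoint (hfc.mono hsx),
    StarAlgHom.map_cfc_real π hρy.isSelfAdjoint (hfc.mono hsy), hπρ, hπρ] at h

open scoped ComplexOrder in
theorem matrixMonotoneClass_eq (n : ℕ) :
    matrixMonotoneClass n (Set.Ici 0) =
      monotoneClass (EuclideanSpace ℂ (Fin n) →L[ℂ] EuclideanSpace ℂ (Fin n)) (Set.Ici 0) :=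
  let e : CStarMatrix (Fin n) (Fin n) ℂ ≃⋆ₐ[ℂ]
      (EuclideanSpace ℂ (Fin n) →L[ℂ] EuclideanSpace ℂ (Fin n)) :=
    CStarMatrix.ofMatrixStarAlgEquiv.symm.trans Matrix.toEuclideanCLM
  Set.Subset.antisymm (monotoneClass_subset_of_starAlgEquiv e)
    (monotoneClass_subset_of_starAlgEquiv e.symm)

variable {H : Type*} [NormedAddCommGroup H] [InnerProductSpace ℂ H]

theorem exists_linearIsometry_of_le_rank {n : ℕ}
    (hn : (n : ℕ∞) ≤ Cardinal.toENat (Module.rank ℂ H)) :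
    Nonempty (EuclideanSpace ℂ (Fin n) →ₗᵢ[ℂ] H) := by
  obtain ⟨b, hb⟩ := exists_linearIndependent_of_le_rank (Cardinal.natCast_le_toENat.1 hn)
  have hfin := finrank_span_eq_card hb
  rw [Fintype.card_fin] at hfin
  have : FiniteDimensional ℂ (Submodule.span ℂ (Set.range b)) :=
    FiniteDimensional.span_of_finite ℂ (Set.finite_range b)
  exact ⟨(Submodule.span ℂ (Set.range b)).subtypeₗᵢ.comp
    ((stdOrthonormalBasis ℂ (Submodule.span ℂ (Set.range b))).reindex
      (finCongr hfin)).repr.symm.toLinearIsometry⟩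

variable [CompleteSpace H]

theorem IsIrreducibleRep.monotoneClass_subset {A : Type*} [CStarAlgebra A] [PartialOrder A]
    [StarOrderedRing A] {π : A →⋆ₐ[ℂ] (H →L[ℂ] H)} (hπ : IsIrreducibleRep π) {n : ℕ}
    (hn : (n : ℕ∞) ≤ Cardinal.toENat (Module.rank ℂ H)) :
    monotoneClass A (Set.Ici 0) ⊆
      monotoneClass (EuclideanSpace ℂ (Fin n) →L[ℂ] EuclideanSpace ℂ (Fin n)) (Set.Ici 0) := by
  obtain ⟨V⟩ := exists_linearIsometry_of_le_rank hn
  exact (hπ.approximatesSelfAdjoint V.adjoint_comp_self).monotoneClass_subset V.adjoint_comp_self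

/-- For the identity representation of `B(H)` no density theorem is needed: the constant sequence `V
u V*` serves as approximant. -/
theorem monotoneClass_subset_of_linearIsometry {E : Type*} [NormedAddCommGroup E]
    [InnerProductSpace ℂ E] [CompleteSpace E] (V : E →ₗᵢ[ℂ] H) :
    monotoneClass (H →L[ℂ] H) (Set.Ici 0) ⊆ monotoneClass (E →L[ℂ] E) (Set.Ici 0) := by
  set W : E →L[ℂ] H := V.toContinuousLinearMap
  have hW : adjoint W ∘L W = 1 := V.adjoint_comp_self
  refine ApproximatesSelfAdjoint.monotoneClass_subset (π := StarAlgHom.id ℂ (H →L[ℂ] H))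
    (V := W) (fun u hu => ⟨fun _ => W ∘L u ∘L adjoint W, fun _ => hu.conj_adjoint W, ?_⟩) hW
  have : StarAlgHom.id ℂ (H →L[ℂ] H) (W ∘L u ∘L adjoint W) ∘L W = W ∘L u := by
    change (W ∘L u ∘L adjoint W) ∘L W = W ∘L u
    rw [comp_assoc, comp_assoc, hW]
    rfl
  exact this ▸ tendsto_const_nhds

theorem monotoneClass_euclideanSpace_subset_of_rank_le {n : ℕ}
    (hn : Cardinal.toENat (Module.rank ℂ H) ≤ n) :
    monotoneClass (EuclideanSpace ℂ (Fin n) →L[ℂ] EuclideanSpace ℂ (Fin n)) (Set.Ici 0) ⊆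
      monotoneClass (H →L[ℂ] H) (Set.Ici 0) := by
  have hr := Cardinal.toENat_le_natCast.1 hn
  have : FiniteDimensional ℂ H :=
    Module.rank_lt_aleph0_iff.1 (hr.trans_lt Cardinal.natCast_lt_aleph0)
  have hfr : ((Module.finrank ℂ H : ℕ) : ℕ∞) ≤
      Cardinal.toENat (Module.rank ℂ (EuclideanSpace ℂ (Fin n))) := by
    rw [← Module.finrank_eq_rank, Nat.cast_le] at hr
    rwa [Cardinal.natCast_le_toENat, ← Module.finrank_eq_rank, finrank_euclideanSpace_fin,
      Nat.cast_le]
  obtain ⟨V⟩ := exists_linearIsometry_of_le_rank hfr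
  exact monotoneClass_subset_of_linearIsometry
    (V.comp (stdOrthonormalBasis ℂ H).repr.toLinearIsometry)

theorem monotoneClass_euclideanSpace_subset_of_irrepDims_le {A : Type*} [CStarAlgebra A]
    [PartialOrder A] [StarOrderedRing A] {n : ℕ} (hn : ∀ d ∈ irrepDims A, d ≤ n) :
    monotoneClass (EuclideanSpace ℂ (Fin n) →L[ℂ] EuclideanSpace ℂ (Fin n)) (Set.Ici 0) ⊆
      monotoneClass A (Set.Ici 0) := by
  intro f hf
  refine ⟨hf.1, fun x y hx hy hxσ hyσ hxy => ?_⟩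
  rw [← sub_nonneg]
  by_contra hneg
  obtain ⟨H, _, _, _, π, hπ, hπneg⟩ := exists_isIrreducibleRep_not_nonneg
    ((cfc_predicate f y : IsSelfAdjoint _).sub (cfc_predicate f x : IsSelfAdjoint _)) hneg
  have hx0 : 0 ≤ x := (StarOrderedRing.nonneg_iff_spectrum_nonneg (R := ℝ) x hx).2 hxσ
  have hπx : 0 ≤ π x := map_nonneg π hx0
  have hπy : 0 ≤ π y := map_nonneg π (hx0.trans hxy)
  have h := (monotoneClass_euclideanSpace_subset_of_rank_le
    (hn _ ⟨H, _, _, _, π, hπ, rfl⟩) hf).2 (π x) (π y) hπx.isSelfAdjoint hπy.isSelfAdjoint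
    (fun t ht => spectrum_nonneg_of_nonneg hπx ht) (fun t ht => spectrum_nonneg_of_nonneg hπy ht)
    (OrderHomClass.mono π hxy)
  rw [map_sub, StarAlgHom.map_cfc_real π hx (hf.1.mono hxσ),
    StarAlgHom.map_cfc_real π hy (hf.1.mono hyσ), sub_nonneg] at hπneg
  exact hπneg h

end Comparison

/-! ### Matrix orders and the supremum of the irreducible dimensions. -/

section Dimension

variable {A : Type*} [CStarAlgebra A] [PartialOrder A] [StarOrderedRing A]

theorem monotoneClass_subset_matrixMonotoneClass {n : ℕ} (hn : (n : ℕ∞) ≤ sSup (irrepDims A)) :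
    monotoneClass A (Set.Ici 0) ⊆ matrixMonotoneClass n (Set.Ici 0) := by
  rw [matrixMonotoneClass_eq]
  rcases n with _ | m
  · exact fun f hf => ⟨hf.1, fun x y _ _ _ _ _ => (Subsingleton.elim _ _).le⟩
  -- An infinite supremum need not be attained; strict inequality at `m` still produces a
  -- representation of dimension at least `m + 1`.
  · have hlt : (m : ℕ∞) < sSup (irrepDims A) :=
      lt_of_lt_of_le (by exact_mod_cast m.lt_succ_self) hn
    obtain ⟨d, ⟨H, _, _, _, π, hπ, rfl⟩, hd⟩ := lt_sSup_iff.1 hlt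
    refine hπ.monotoneClass_subset ?_
    rw [Nat.cast_add, Nat.cast_one]
    exact Order.add_one_le_of_lt hd

theorem matrixMonotoneClass_subset_monotoneClass {n : ℕ} (hn : sSup (irrepDims A) ≤ n) :
    matrixMonotoneClass n (Set.Ici 0) ⊆ monotoneClass A (Set.Ici 0) := by
  rw [matrixMonotoneClass_eq]
  exact monotoneClass_euclideanSpace_subset_of_irrepDims_le fun d hd => (le_sSup hd).trans hn

theorem not_matrixMonotoneClass_subset {m n : ℕ} (hmn : m < n) :
    ¬ matrixMonotoneClass m (Set.Ici 0) ⊆ matrixMonotoneClass n (Set.Ici 0) := by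
  intro h
  obtain ⟨f, hf, hf'⟩ := exists_monotoneClass_gap m
  rw [matrixMonotoneClass_eq, matrixMonotoneClass_eq] at h
  refine hf' (monotoneClass_euclideanSpace_subset_of_rank_le ?_ (h hf))
  rw [← Module.finrank_eq_rank, finrank_euclideanSpace_fin, Cardinal.toENat_le_natCast]
  exact_mod_cast hmn

end Dimension

theorem corollary2p2 {A : Type*} [CStarAlgebra A] [PartialOrder A] [StarOrderedRing A] :
    sSup {k : ℕ∞ | ∃ n : ℕ, 0 < n ∧ k = n ∧
        monotoneClass A (Set.Ici 0) ⊆ matrixMonotoneClass n (Set.Ici 0)} = sSup (irrepDims A) ∧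
      ∀ n₁ : ℕ, sSup (irrepDims A) = n₁ →
        monotoneClass A (Set.Ici 0) = matrixMonotoneClass n₁ (Set.Ici 0) := by
  refine ⟨le_antisymm (sSup_le ?_) (ENat.forall_natCast_le_iff_le.1 fun n hn => ?_), fun n hn =>
    Set.Subset.antisymm (monotoneClass_subset_matrixMonotoneClass hn.ge)
      (matrixMonotoneClass_subset_monotoneClass hn.le)⟩
  · rintro _ ⟨n, -, rfl, hn⟩
    by_contra! hlt
    obtain ⟨m, hm⟩ := ENat.ne_top_iff_exists.1 hlt.ne_top
    rw [← hm] at hlt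
    exact not_matrixMonotoneClass_subset (Nat.cast_lt.1 hlt)
      ((matrixMonotoneClass_subset_monotoneClass hm.ge).trans hn)
  · rcases n.eq_zero_or_pos with rfl | hpos
    · simp
    · exact le_sSup ⟨n, hpos, rfl, monotoneClass_subset_matrixMonotoneClass hn⟩
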